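/- **Setting.** Let $d\ge 1$, let $\Omega\subset\mathbb R^d$ be nonempty, open and bounded, let $\tau>0$, let $\Psi:\overline\Omega\to\mathbb R$ be Lipschitz and let $e:\mathbb R\times\overline\Omega\to\mathbb R\cup\{+\infty\}$, $e_x:=e(\cdot,x)$, satisfy: - for each $x\in\overline\Omega$, $e_x$ is lower semicontinuous and strictly convex (on $\{e_x<\infty\}$); - for each $L\in\mathbb R$ there is $C(L)\in\mathbb R$ with $e(z,x)\ge L|z|+C(L)$ for all $(z,x)\in\mathbb R\times\overline\Omega$; - $e$ is Lipschitz on every compact subset of $D(e)$, the interior of $\{e<\infty\}$ relative to $\mathbb R\times\overline\Omega$; - there is a constant $a\in[-\infty,\infty)$ such that, for every $x\in\Omega$, the interior of $\{z: e(z,x)<\infty\}$ is $(a,\infty)$; - $\int_\Omega e(0,x)\,dx=0$. Let $\mu$ and $\nu=\rho\,dx$ be finite positive absolutely continuous measures on $\Omega$. For a positive measure $\gamma$ on $\overline\Omega\times\overline\Omega$ write $\gamma_A^B$ for its restriction to $A\times B$. The set $ADM(\mu,\nu)$ consists of the pairs $(\gamma,h)$ with $\gamma$ a positive measure on $\overline\Omega\times\overline\Omega$,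 $h\in L^1(\Omega)$, $$\pi_{2\#}\gamma_{\overline\Omega}^{\Omega}=\rho\,dx+\tau h\,dx,\qquad \pi_{1\#}\gamma_{\Omega}^{\overline\Omega}=\mu ,$$ and $Opt(\mu,\nu)$ is the set of minimizers over $ADM(\mu,\nu)$ of $$C_\tau(\gamma,h)=\int_{(\overline\Omega\times\overline\Omega)\setminus(\partial\Omega\times\partial\Omega)}\Big(\frac{|x-y|^2}{2\tau}+\Psi(y)1_{\Omega\times\partial\Omega}-\Psi(x)1_{\partial\Omega\times\Omega}\Big)d\gamma+\tau\int_\Omega e(h(x),x)\,dx .$$ For $c(x,y)=\frac{|x-y|^2}{2\tau}$ let $c_1=c|_{\Omega\times\overline\Omega}$ and $c_2=c|_{\overline\Omega\times\Omega}$, and use the usual transforms, concavity and superdifferentials $\partial^{c_i}$ for these costs. The support of a measure on $\overline\Omega\times\overline\Omega$ is taken in the disjoint union topology of $\Omega\times\Omega$, $\Omega\times\partial\Omega$, $\partial\Omega\times\Omega$, $\partial\Omega\times\partial\Omega$. Call $\varphi,\varphi^*:\overline\Omega\to\mathbb R$ a *pair of potentials for $\gamma$* if - (a) $\varphi|_\Omega$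 is $c_1$-concave with $\varphi(x)=\inf_{y\in\overline\Omega}\big(c(x,y)-\varphi^*(y)\big)$ for $x\in\Omega$, and $\varphi^*|_\Omega$ is $c_2$-concave with $\varphi^*(y)=\inf_{x\in\overline\Omega}\big(c(x,y)-\varphi(x)\big)$ for $y\in\Omega$; - (b) $\operatorname{supp}(\gamma_\Omega^{\overline\Omega})\subset\partial^{c_1}(\varphi|_\Omega)$ and $\operatorname{supp}(\gamma_{\overline\Omega}^{\Omega})\subset\partial^{c_2}(\varphi^*|_\Omega)$; - (c) $\varphi=\Psi$ and $\varphi^*=-\Psi$ on $\partial\Omega$. **Statement (uniqueness of optimal pairs).** Let $(\gamma,h)\in Opt(\mu,\nu)$, and assume that $\mu$ and $\nu+\tau h\,dx$ are strictly positive, i.e. their densities are positive a.e. in $\Omega$. Then: 1. $h$ is unique $\mathcal L^d$-a.e.: if $(\gamma',h')\in Opt(\mu,\nu)$, then $h'=h$ a.e. in $\Omega$. 2. $\gamma$ admits a pair of potentials. 3. The plan $\gamma_\Omega^{\overline\Omega}$ is unique (every $(\gamma',h')\in Opt(\mu,\nu)$ has the same restriction), and $\gamma_\Omega^{\overline\Omega}=(\mathrm{Id},T)_\#\mu$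 for a Borel map $T:\Omega\to\overline\Omega$ that coincides a.e. in $\Omega$ with the gradient of a convex function on $\mathbb R^d$. For every pair of potentials $(\varphi,\varphi^*)$ for $\gamma$, $\varphi$ is differentiable a.e. in $\Omega$ and $-\nabla\varphi=\frac{T-\mathrm{Id}}{\tau}$ a.e. in $\Omega$. 4. The plan $\gamma_{\overline\Omega}^{\Omega}$ is unique in the same sense, and $\gamma_{\overline\Omega}^{\Omega}=(S,\mathrm{Id})_\#(\nu+\tau h\,dx)$ for a Borel map $S:\Omega\to\overline\Omega$ that coincides a.e. in $\Omega$ with the gradient of a convex function on $\mathbb R^d$. For every pair of potentials $(\varphi,\varphi^*)$ for $\gamma$, $\varphi^*$ is differentiable a.e. in $\Omega$ and $-\nabla\varphi^*=\frac{S-\mathrm{Id}}{\tau}$ a.e. in $\Omega$. 5. If $\gamma(\partial\Omega\times\partial\Omega)=0$, then $\gamma$ is unique: every $(\gamma',h')\in Opt(\mu,\nu)$ with $\gamma'(\partial\Omega\times\partial\Omega)=0$ satisfies $\gamma'=\gamma$. -/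

import Mathlib

open MeasureTheory Set Filter Topology

noncomputable section

/-- The Euclidean space of dimension `d`. -/
abbrev Space (d : ℕ) : Type := EuclideanSpace ℝ (Fin d)

/-- The integral `∫_Ω e(h(x), x) dx` as an extended real: integral of the positive part minus
integral of the negative part (the latter is finite as soon as `e` is bounded below and `Ω` is
bounded). -/
def reactionEnergy {d : ℕ} (Ω : Set (Space d)) (e : ℝ → Space d → EReal) (h : Space d → ℝ) :
    EReal :=
  ((∫⁻ x in Ω, (e (h x) x).toENNReal : ENNReal) : EReal)
    - ((∫⁻ x in Ω, (-(e (h x) x)).toENNReal : ENNReal) : EReal)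

/-- `D(e)`: the interior, relative to `ℝ × closure Ω`, of the set where `e` is finite. -/
def finiteDomain {d : ℕ} (Ω : Set (Space d)) (e : ℝ → Space d → EReal) : Set (ℝ × Space d) :=
  {p | p.2 ∈ closure Ω ∧ {q : ℝ × Space d | e q.1 q.2 < ⊤} ∈ 𝓝[univ ×ˢ closure Ω] p}

/-- `D(e_x)`: the interior of the set of `z` with `e z x` finite. -/
def finiteDomainAt {d : ℕ} (e : ℝ → Space d → EReal) (x : Space d) : Set ℝ :=
  interior {z | e z x < ⊤}

/-- The assumptions on the boundary potential `Ψ` and on the reaction cost `e`. Only the values of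
`Ψ` on `closure Ω` and of `e` on `ℝ × closure Ω` matter. -/
structure CostData {d : ℕ} (Ω : Set (Space d)) (Ψ : Space d → ℝ) (e : ℝ → Space d → EReal) :
    Prop where
  lipschitz_bdry : ∃ K, LipschitzOnWith K Ψ (closure Ω)
  strictConvex : ∀ x ∈ closure Ω,
    StrictConvexOn ℝ {z | e z x < ⊤} (fun z => (e z x).toReal)
  lsc : ∀ x ∈ closure Ω, LowerSemicontinuous (fun z => e z x)
  superlinear : ∀ L : ℝ, ∃ C : ℝ, ∀ z : ℝ, ∀ x ∈ closure Ω, ((L * |z| + C : ℝ) : EReal) ≤ e z x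
  locallyLipschitz : ∀ K : Set (ℝ × Space d), IsCompact K → K ⊆ finiteDomain Ω e →
    ∃ L, LipschitzOnWith L (fun p : ℝ × Space d => (e p.1 p.2).toReal) K
  domain : ∃ a : EReal, a < ⊤ ∧ ∀ x ∈ Ω, finiteDomainAt e x = {z : ℝ | a < (z : EReal)}
  normalized : reactionEnergy Ω e (fun _ => 0) = 0

/-- `γ_A^B`: the restriction of the plan `γ` to `A × B`. -/
def planRestrict {d : ℕ} (γ : Measure (Space d × Space d)) (A B : Set (Space d)) :
    Measure (Space d × Space d) :=
  γ.restrict (A ×ˢ B)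

/-- The measure `(ρ + τ h) dx` on `Ω` (used when `ρ + τ h ≥ 0` a.e. in `Ω`). -/
def targetMeasure {d : ℕ} (Ω : Set (Space d)) (τ : ℝ) (ρ h : Space d → ℝ) : Measure (Space d) :=
  (volume.restrict Ω).withDensity (fun y => ENNReal.ofReal (ρ y + τ * h y))

/-- `(γ, h)` is an admissible pair for `μ` and `ρ dx`: `γ` is a positive measure on
`closure Ω × closure Ω`, `h ∈ L¹(Ω)`, the second marginal of `γ` restricted to `closure Ω × Ω` is
`ρ dx + τ h dx` (in particular the signed measure on the right is nonnegative), and the first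
marginal of `γ` restricted to `Ω × closure Ω` is `μ`. -/
structure IsAdmissible {d : ℕ} (Ω : Set (Space d)) (τ : ℝ) (μ : Measure (Space d))
    (ρ : Space d → ℝ) (γ : Measure (Space d × Space d)) (h : Space d → ℝ) : Prop where
  supported : γ (closure Ω ×ˢ closure Ω)ᶜ = 0
  integrable : IntegrableOn h Ω
  target_nonneg : ∀ᵐ y ∂(volume.restrict Ω), 0 ≤ ρ y + τ * h y
  snd_marginal : (planRestrict γ (closure Ω) Ω).map Prod.snd = targetMeasure Ω τ ρ h
  fst_marginal : (planRestrict γ Ω (closure Ω)).map Prod.fst = μ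

/-- The cost `C_τ(γ, h)`. -/
def pairCost {d : ℕ} (Ω : Set (Space d)) (Ψ : Space d → ℝ) (e : ℝ → Space d → EReal) (τ : ℝ)
    (γ : Measure (Space d × Space d)) (h : Space d → ℝ) : EReal :=
  ((∫ p in (closure Ω ×ˢ closure Ω) \ (frontier Ω ×ˢ frontier Ω),
      (‖p.1 - p.2‖ ^ 2 / (2 * τ)
        + (Ω ×ˢ frontier Ω).indicator (fun q => Ψ q.2) p
        - (frontier Ω ×ˢ Ω).indicator (fun q => Ψ q.1) p) ∂γ : ℝ) : EReal)
    + (τ : EReal) * reactionEnergy Ω e h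

/-- `(γ, h)` minimizes `C_τ` among all admissible pairs. -/
def IsOptimalPair {d : ℕ} (Ω : Set (Space d)) (Ψ : Space d → ℝ) (e : ℝ → Space d → EReal) (τ : ℝ)
    (μ : Measure (Space d)) (ρ : Space d → ℝ)
    (γ : Measure (Space d × Space d)) (h : Space d → ℝ) : Prop :=
  IsAdmissible Ω τ μ ρ γ h ∧
    ∀ γ' h', IsAdmissible Ω τ μ ρ γ' h' → pairCost Ω Ψ e τ γ h ≤ pairCost Ω Ψ e τ γ' h'

/-- Open sets of the topology on `closure Ω × closure Ω` which is the disjoint union of the product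
topologies of `Ω × Ω`, `Ω × ∂Ω`, `∂Ω × Ω` and `∂Ω × ∂Ω`. -/
def IsSplitOpen {d : ℕ} (Ω : Set (Space d)) (G : Set (Space d × Space d)) : Prop :=
  G ⊆ closure Ω ×ˢ closure Ω ∧
    ∀ A ∈ ({Ω, frontier Ω} : Set (Set (Space d))), ∀ B ∈ ({Ω, frontier Ω} : Set (Set (Space d))),
      ∃ O : Set (Space d × Space d), IsOpen O ∧ G ∩ A ×ˢ B = O ∩ A ×ˢ B

/-- The support of a measure on `closure Ω × closure Ω` for the disjoint union topology. -/
def splitSupport {d : ℕ} (Ω : Set (Space d)) (γ : Measure (Space d × Space d)) :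
    Set (Space d × Space d) :=
  {p | p ∈ closure Ω ×ˢ closure Ω ∧ ∀ G, IsSplitOpen Ω G → p ∈ G → 0 < γ G}

/-- The transform `x ↦ inf_{y ∈ Y} (|x - y|² / (2τ) - ψ(y))`. The cost is symmetric, so the same
formula gives the transforms in both variables. -/
def quadTransform {d : ℕ} (τ : ℝ) (Y : Set (Space d)) (ψ : Space d → EReal) (x : Space d) :
    EReal :=
  ⨅ y ∈ Y, (((‖x - y‖ ^ 2 / (2 * τ) : ℝ) : EReal) - ψ y)

/-- `f`, as a function on `X`, is concave for the cost `|x - y|² / (2τ)` between `X` and `Y`. -/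
def IsQuadConcave {d : ℕ} (τ : ℝ) (X Y : Set (Space d)) (f : Space d → ℝ) : Prop :=
  ∃ ψ : Space d → EReal, ∀ x ∈ X, (f x : EReal) = quadTransform τ Y ψ x

/-- The superdifferential of `f|_X` for the cost `|x - y|² / (2τ)` between `X` and `Y`: the pairs
`(x, y) ∈ X × Y` at which `f(x)` plus the transform of `f|_X` at `y` equals the cost. -/
def quadSuperdiff {d : ℕ} (τ : ℝ) (X Y : Set (Space d)) (f : Space d → ℝ) :
    Set (Space d × Space d) :=
  {p | p.1 ∈ X ∧ p.2 ∈ Y ∧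
    (f p.1 : EReal) + quadTransform τ X (fun x => (f x : EReal)) p.2
      = ((‖p.1 - p.2‖ ^ 2 / (2 * τ) : ℝ) : EReal)}

/-- `(φ, φs)` is a pair of potentials for the plan `γ`. Only the values on `closure Ω` matter. -/
structure IsPotentialPair {d : ℕ} (Ω : Set (Space d)) (Ψ : Space d → ℝ) (τ : ℝ)
    (γ : Measure (Space d × Space d)) (φ φs : Space d → ℝ) : Prop where
  concave : IsQuadConcave τ Ω (closure Ω) φ
  eq_transform : ∀ x ∈ Ω, (φ x : EReal) = quadTransform τ (closure Ω) (fun y => (φs y : EReal)) x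
  concave_star : IsQuadConcave τ Ω (closure Ω) φs
  eq_transform_star :
    ∀ y ∈ Ω, (φs y : EReal) = quadTransform τ (closure Ω) (fun x => (φ x : EReal)) y
  support_subset :
    splitSupport Ω (planRestrict γ Ω (closure Ω)) ⊆ quadSuperdiff τ Ω (closure Ω) φ
  support_subset_star :
    splitSupport Ω (planRestrict γ (closure Ω) Ω)
      ⊆ Prod.swap ⁻¹' quadSuperdiff τ Ω (closure Ω) φs
  boundary : ∀ x ∈ frontier Ω, φ x = Ψ x
  boundary_star : ∀ y ∈ frontier Ω, φs y = -Ψ y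

/-- `T` is, almost everywhere in `Ω`, the gradient of a convex function. -/
def IsConvexGradientOn {d : ℕ} (Ω : Set (Space d)) (T : Space d → Space d) : Prop :=
  ∃ u : Space d → ℝ, ConvexOn ℝ univ u ∧ ∀ᵐ x ∂(volume.restrict Ω), HasGradientAt u (T x) x

end

/-!
# Uniqueness of optimal pairs for a transport problem with reaction

The reaction term is unique because the midpoint of two optimal pairs is admissible, the transport
cost is linear in the plan, and the reaction energy is strictly convex. The energy of an optimal
pair is finite (`IsOptimalPair.reactionEnergy_ne_top`), since some admissible pair routes all the
mass through one boundary point and has no reaction. Strict convexity of the integral needs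
measurability of `x ↦ e (h x) x` (`CostData.aemeasurable`).

For a fixed reaction term the plan solves an optimal transport problem in which the boundary is a
reservoir. Charging nothing to mass moving from the boundary to the boundary (`splitCost`) makes
this an ordinary transport problem on `closure Ω`, in which every pair of boundary points may be
added to the support of the plan. Rockafellar's construction with base point on the boundary
(`exists_conjugate_potentials`) then gives conjugate potentials that vanish on `∂Ω`; adding back
`Ψ` and `-Ψ` there gives a pair of potentials. The hypothesis of the construction is that chains of
pairs issued from a boundary point cannot be closed up with a gain
(`IsTransportMinimal.costChain_nonneg`): by induction, each chain is realized by removing from the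
plan a small mass near its pairs and adding products of the marginals of the removed pieces
(`exists_modification_of_costChain`), and closing the chain yields a competitor.

A potential is `‖x‖² / 2τ - u(x) / τ` in `Ω`, with `u` a supremum of affine functions with slopes in
`closure Ω`, so it is differentiable a.e. by Rademacher's theorem
(`exists_convex_gradient_of_eq_quadTransform`), and where it is differentiable its superdifferential
is the single point `∇u(x)`. Hence the part of the plan leaving `Ω` is carried by the graph of
`∇u`. The midpoint of two optimal pairs is optimal (`IsOptimalPair.midpoint`), so it has potentials,
and both plans are carried by the same graph: this gives uniqueness. Exchanging the two variables
handles the part of the plan arriving in `Ω`.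
-/

/-! ### Potentials from chains -/

/-- Chains of pairs of `Γ` starting from the base point `b`. `CostChain C Γ b y V` says that some
chain ends at the second coordinate `y` and that the sum of the increments
`C(xᵢ₊₁, yᵢ) - C(xᵢ₊₁, yᵢ₊₁)` along it is `V`. -/
inductive CostChain {X : Type*} (C : X → X → ℝ) (Γ : Set (X × X)) (b : X) : X → ℝ → Prop
  | base : CostChain C Γ b b 0
  | step {y V x' y'} : CostChain C Γ b y V → (x', y') ∈ Γ →
      CostChain C Γ b y' (V + C x' y - C x' y')

/-- Rockafellar's construction: if chains issued from `b` cannot be closed up with a gain, then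
there are conjugate potentials, vanishing at `b`, which saturate the constraint on `Γ`. -/
theorem exists_conjugate_potentials {X : Type*} (C : X → X → ℝ) (Γ : Set (X × X)) (b : X)
    {M : ℝ} (hM : ∀ x y, |C x y| ≤ M) (hb : C b b = 0)
    (hΓ : ∀ y V, CostChain C Γ b y V → 0 ≤ V + C b y) :
    ∃ f g : X → ℝ, (∀ x y, f x + g y ≤ C x y) ∧
      (∀ x, ∀ ε > 0, ∃ y, C x y - g y < f x + ε) ∧
      (∀ y, ∀ ε > 0, ∃ x, C x y - f x < g y + ε) ∧
      (∀ p ∈ Γ, f p.1 + g p.2 = C p.1 p.2) ∧ f b = 0 := by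
  let A : X → Set ℝ := fun x => {r | ∃ y V, CostChain C Γ b y V ∧ r = V + C x y}
  have hAne : ∀ x, (A x).Nonempty := fun x => ⟨_, b, 0, CostChain.base, rfl⟩
  have hAlow : ∀ x, ∀ r ∈ A x, -(2 * M) ≤ r := by
    rintro x r ⟨y, V, hc, rfl⟩
    have h1 := hΓ y V hc
    have h2 := abs_le.1 (hM b y)
    have h3 := abs_le.1 (hM x y)
    linarith
  have hAbdd : ∀ x, BddBelow (A x) := fun x => ⟨_, hAlow x⟩
  let f : X → ℝ := fun x => sInf (A x)
  have hf_le : ∀ x y V, CostChain C Γ b y V → f x ≤ V + C x y := fun x y V hc =>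
    csInf_le (hAbdd x) ⟨y, V, hc, rfl⟩
  have hf_bound : ∀ x, f x ≤ M := fun x => by
    have h1 := hf_le x b 0 CostChain.base
    have h2 := abs_le.1 (hM x b)
    linarith
  let B : X → Set ℝ := fun y => range fun x => C x y - f x
  have hBne : ∀ y, (B y).Nonempty := fun y => ⟨_, b, rfl⟩
  have hBbdd : ∀ y, BddBelow (B y) := fun y => ⟨-(2 * M), by
    rintro r ⟨x, rfl⟩
    have h1 := hf_bound x
    have h2 := abs_le.1 (hM x y)
    dsimp only
    linarith⟩
  let g : X → ℝ := fun y => sInf (B y)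
  have hg_le : ∀ x y, g y ≤ C x y - f x := fun x y => csInf_le (hBbdd y) ⟨x, rfl⟩
  have hg_chain : ∀ y V, CostChain C Γ b y V → -V ≤ g y := fun y V hc => by
    refine le_csInf (hBne y) ?_
    rintro r ⟨x, rfl⟩
    have h1 := hf_le x y V hc
    dsimp only
    linarith
  refine ⟨f, g, fun x y => by linarith [hg_le x y], ?_, ?_, ?_, ?_⟩
  · intro x ε hε
    obtain ⟨r, ⟨y, V, hc, rfl⟩, hr⟩ := exists_lt_of_csInf_lt (hAne x)
      (show sInf (A x) < f x + ε by simpa [f] using hε)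
    exact ⟨y, by linarith [hg_chain y V hc]⟩
  · intro y ε hε
    obtain ⟨r, ⟨x, rfl⟩, hr⟩ := exists_lt_of_csInf_lt (hBne y)
      (show sInf (B y) < g y + ε by simpa [g] using hε)
    exact ⟨x, hr⟩
  · rintro ⟨x, y⟩ hp
    refine le_antisymm (by linarith [hg_le x y]) ?_
    have : C x y - g y ≤ f x := by
      refine le_csInf (hAne x) ?_
      rintro r ⟨y₀, V, hc, rfl⟩
      have h1 := hg_chain _ _ (hc.step hp)
      linarith
    dsimp only
    linarith
  · refine le_antisymm (by linarith [hf_le b b 0 CostChain.base]) (le_csInf (hAne b) ?_)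
    rintro r ⟨y, V, hc, rfl⟩
    exact hΓ y V hc

/-! ### The transport cost -/

/-- The pairs on which the transport cost is charged: all pairs of points of `closure Ω`, except
those with both points on the boundary. -/
def interiorPairs {d : ℕ} (Ω : Set (Space d)) : Set (Space d × Space d) :=
  (closure Ω ×ˢ closure Ω) \ (frontier Ω ×ˢ frontier Ω)

/-- The transport cost density, extended by `0` outside `interiorPairs Ω`. With this convention
mass travelling from the boundary to the boundary is free, so that the boundary acts as a single
reservoir. -/
noncomputable def splitCost {d : ℕ} (Ω : Set (Space d)) (Ψ : Space d → ℝ) (τ : ℝ) :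
    Space d × Space d → ℝ :=
  (interiorPairs Ω).indicator fun p =>
    ‖p.1 - p.2‖ ^ 2 / (2 * τ)
      + (Ω ×ˢ frontier Ω).indicator (fun q => Ψ q.2) p
      - (frontier Ω ×ˢ Ω).indicator (fun q => Ψ q.1) p

open Classical in
/-- The stratum, `Ω` or its boundary, to which a point of `closure Ω` belongs. -/
noncomputable def stratum {d : ℕ} (Ω : Set (Space d)) (x : Space d) : Set (Space d) :=
  if x ∈ Ω then Ω else frontier Ω

section

variable {d : ℕ} {Ω : Set (Space d)} {Ψ : Space d → ℝ} {τ : ℝ}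

theorem notMem_frontier_of_mem_isOpen (hΩ : IsOpen Ω) {x : Space d} (hx : x ∈ Ω) :
    x ∉ frontier Ω := by
  rw [hΩ.frontier_eq]; exact fun h => h.2 hx

theorem mem_frontier_of_notMem (hΩ : IsOpen Ω) {x : Space d} (hx : x ∈ closure Ω) (hx' : x ∉ Ω) :
    x ∈ frontier Ω := by
  rw [hΩ.frontier_eq]; exact ⟨hx, hx'⟩

theorem measurableSet_interiorPairs : MeasurableSet (interiorPairs Ω) :=
  (isClosed_closure.prod isClosed_closure).measurableSet.diff
    (isClosed_frontier.prod isClosed_frontier).measurableSet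

theorem mem_stratum (hΩ : IsOpen Ω) {x : Space d} (hx : x ∈ closure Ω) : x ∈ stratum Ω x := by
  unfold stratum
  split_ifs with h
  · exact h
  · exact mem_frontier_of_notMem hΩ hx h

theorem stratum_subset_closure {x : Space d} : stratum Ω x ⊆ closure Ω := by
  unfold stratum
  split_ifs
  · exact subset_closure
  · exact frontier_subset_closure

theorem measurableSet_stratum (hΩ : IsOpen Ω) {x : Space d} : MeasurableSet (stratum Ω x) := by
  unfold stratum
  split_ifs
  · exact hΩ.measurableSet
  · exact isClosed_frontier.measurableSet

theorem splitCost_of_mem_of_mem (hΩ : IsOpen Ω) {x y : Space d} (hx : x ∈ Ω) (hy : y ∈ Ω) :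
    splitCost Ω Ψ τ (x, y) = ‖x - y‖ ^ 2 / (2 * τ) := by
  have hx' := notMem_frontier_of_mem_isOpen hΩ hx
  have hy' := notMem_frontier_of_mem_isOpen hΩ hy
  have hxc := subset_closure hx
  have hyc := subset_closure hy
  simp [splitCost, interiorPairs, indicator, *]

theorem splitCost_of_mem_of_frontier (hΩ : IsOpen Ω) {x y : Space d} (hx : x ∈ Ω)
    (hy : y ∈ frontier Ω) :
    splitCost Ω Ψ τ (x, y) = ‖x - y‖ ^ 2 / (2 * τ) + Ψ y := by
  have hx' := notMem_frontier_of_mem_isOpen hΩ hx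
  have hxc := subset_closure hx
  have hyc := frontier_subset_closure hy
  simp [splitCost, interiorPairs, indicator, *]

theorem splitCost_of_frontier_of_mem (hΩ : IsOpen Ω) {x y : Space d} (hx : x ∈ frontier Ω)
    (hy : y ∈ Ω) :
    splitCost Ω Ψ τ (x, y) = ‖x - y‖ ^ 2 / (2 * τ) - Ψ x := by
  have hy' := notMem_frontier_of_mem_isOpen hΩ hy
  have hyc := subset_closure hy
  have hxc := frontier_subset_closure hx
  simp [splitCost, interiorPairs, indicator, *]

theorem splitCost_of_frontier_of_frontier {x y : Space d} (hx : x ∈ frontier Ω)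
    (hy : y ∈ frontier Ω) : splitCost Ω Ψ τ (x, y) = 0 := by
  simp [splitCost, interiorPairs, indicator, *]

theorem splitCost_of_notMem {p : Space d × Space d} (hp : p ∉ interiorPairs Ω) :
    splitCost Ω Ψ τ p = 0 := indicator_of_notMem hp _

theorem measurable_splitCost (hΩ : IsOpen Ω) (hΨ : ContinuousOn Ψ (closure Ω)) :
    Measurable (splitCost Ω Ψ τ) := by
  classical
  have hfr : Measurable ((frontier Ω).indicator Ψ) := by
    rw [← piecewise_eq_indicator]
    exact (hΨ.mono frontier_subset_closure).measurable_piecewise continuousOn_const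
      isClosed_frontier.measurableSet
  have h1 : (Ω ×ˢ frontier Ω).indicator (fun q : Space d × Space d => Ψ q.2)
      = (Ω ×ˢ frontier Ω).indicator fun q => (frontier Ω).indicator Ψ q.2 :=
    indicator_congr fun p hp => by rw [indicator_of_mem hp.2]
  have h2 : (frontier Ω ×ˢ Ω).indicator (fun q : Space d × Space d => Ψ q.1)
      = (frontier Ω ×ˢ Ω).indicator fun q => (frontier Ω).indicator Ψ q.1 :=
    indicator_congr fun p hp => by rw [indicator_of_mem hp.1]
  have hfm : MeasurableSet (frontier Ω) := isClosed_frontier.measurableSet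
  unfold splitCost
  rw [h1, h2]
  refine Measurable.indicator (Measurable.sub (Measurable.add (by fun_prop) ?_) ?_)
    measurableSet_interiorPairs
  · exact (hfr.comp measurable_snd).indicator (hΩ.measurableSet.prod hfm)
  · exact (hfr.comp measurable_fst).indicator (hfm.prod hΩ.measurableSet)

theorem exists_abs_splitCost_le (hΩ : IsOpen Ω) (hb : Bornology.IsBounded Ω)
    (hΨ : ContinuousOn Ψ (closure Ω)) : ∃ M, ∀ p, |splitCost Ω Ψ τ p| ≤ M := by
  have hcomp : IsCompact (closure Ω) := hb.isCompact_closure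
  obtain ⟨M₁, hM₁⟩ := hcomp.exists_bound_of_continuousOn hΨ
  obtain ⟨M₂, hM₂⟩ := (hcomp.prod hcomp).exists_bound_of_continuousOn
    (f := fun p : Space d × Space d => ‖p.1 - p.2‖ ^ 2 / (2 * τ)) (by fun_prop)
  refine ⟨max (M₂ + M₁) 0, fun ⟨x, y⟩ => ?_⟩
  by_cases hp : (x, y) ∈ interiorPairs Ω
  · refine le_max_of_le_left ?_
    have hx := hp.1.1
    have hy := hp.1.2
    have h1 := abs_le.1 (hM₁ x hx)
    have h2 := abs_le.1 (hM₁ y hy)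
    have h3 := abs_le.1 (hM₂ (x, y) hp.1)
    dsimp only at h1 h2 h3 hx hy
    by_cases hxΩ : x ∈ Ω <;> by_cases hyΩ : y ∈ Ω
    · rw [splitCost_of_mem_of_mem hΩ hxΩ hyΩ, abs_le]
      constructor <;> linarith
    · rw [splitCost_of_mem_of_frontier hΩ hxΩ (mem_frontier_of_notMem hΩ hy hyΩ), abs_le]
      constructor <;> linarith
    · rw [splitCost_of_frontier_of_mem hΩ (mem_frontier_of_notMem hΩ hx hxΩ) hyΩ, abs_le]
      constructor <;> linarith
    · rw [splitCost_of_frontier_of_frontier (mem_frontier_of_notMem hΩ hx hxΩ)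
        (mem_frontier_of_notMem hΩ hy hyΩ), abs_le]
      constructor <;> linarith
  · simp [splitCost_of_notMem hp]

/-- The cost is discontinuous across the strata, but continuous within each product of strata; this
is why supports are taken in the disjoint union topology. -/
theorem continuousOn_splitCost (hΩ : IsOpen Ω) (hΨ : ContinuousOn Ψ (closure Ω)) (x y : Space d) :
    ContinuousOn (splitCost Ω Ψ τ) (stratum Ω x ×ˢ stratum Ω y) := by
  have hΨ' := hΨ.mono frontier_subset_closure
  have hq : ∀ s, ContinuousOn (fun p : Space d × Space d => ‖p.1 - p.2‖ ^ 2 / (2 * τ)) s :=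
    fun s => by fun_prop
  unfold stratum
  split_ifs
  · exact (hq _).congr fun p hp => splitCost_of_mem_of_mem hΩ hp.1 hp.2
  · exact ((hq _).add (hΨ'.comp continuousOn_snd fun p hp => hp.2)).congr
      fun p hp => splitCost_of_mem_of_frontier hΩ hp.1 hp.2
  · exact ((hq _).sub (hΨ'.comp continuousOn_fst fun p hp => hp.1)).congr
      fun p hp => splitCost_of_frontier_of_mem hΩ hp.1 hp.2
  · exact continuousOn_const.congr fun p hp => splitCost_of_frontier_of_frontier hp.1 hp.2

theorem interiorPairs_subset : interiorPairs Ω ⊆ closure Ω ×ˢ closure Ω := sdiff_subset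

theorem integrable_splitCost (hΩ : IsOpen Ω) (hb : Bornology.IsBounded Ω)
    (hΨ : ContinuousOn Ψ (closure Ω)) (ν : Measure (Space d × Space d)) [IsFiniteMeasure ν] :
    Integrable (splitCost Ω Ψ τ) ν := by
  obtain ⟨M, hM⟩ := exists_abs_splitCost_le (τ := τ) hΩ hb hΨ
  exact Integrable.of_bound (measurable_splitCost hΩ hΨ).aestronglyMeasurable M
    (Eventually.of_forall hM)

theorem setIntegral_interiorPairs_splitCost (ν : Measure (Space d × Space d)) :
    ∫ p in interiorPairs Ω, splitCost Ω Ψ τ p ∂ν = ∫ p, splitCost Ω Ψ τ p ∂ν :=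
  setIntegral_eq_integral_of_forall_compl_eq_zero fun _ hp => splitCost_of_notMem hp

/-! ### Marginals of restricted plans -/

variable {ν : Measure (Space d × Space d)}

theorem planRestrict_map_fst (hΩ : IsOpen Ω) (hν : ν (closure Ω ×ˢ closure Ω)ᶜ = 0) :
    (planRestrict ν Ω (closure Ω)).map Prod.fst = (ν.map Prod.fst).restrict Ω := by
  rw [Measure.restrict_map measurable_fst hΩ.measurableSet, planRestrict]
  congr 1
  refine Measure.restrict_congr_set ?_
  filter_upwards [compl_mem_ae_iff.2 hν] with p hp
  rw [compl_compl] at hp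
  exact propext ⟨fun h => h.1, fun h => ⟨h, hp.2⟩⟩

theorem planRestrict_map_snd (hΩ : IsOpen Ω) (hν : ν (closure Ω ×ˢ closure Ω)ᶜ = 0) :
    (planRestrict ν (closure Ω) Ω).map Prod.snd = (ν.map Prod.snd).restrict Ω := by
  rw [Measure.restrict_map measurable_snd hΩ.measurableSet, planRestrict]
  congr 1
  refine Measure.restrict_congr_set ?_
  filter_upwards [compl_mem_ae_iff.2 hν] with p hp
  rw [compl_compl] at hp
  exact propext ⟨fun h => h.2, fun h => ⟨hp.1, h⟩⟩

theorem restrict_interiorPairs_map_fst (hΩ : IsOpen Ω) (hν : ν (closure Ω ×ˢ closure Ω)ᶜ = 0) :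
    ((ν.restrict (interiorPairs Ω)).map Prod.fst).restrict Ω = (ν.map Prod.fst).restrict Ω := by
  rw [Measure.restrict_map measurable_fst hΩ.measurableSet,
    Measure.restrict_map measurable_fst hΩ.measurableSet,
    Measure.restrict_restrict (measurable_fst hΩ.measurableSet)]
  congr 1
  refine Measure.restrict_congr_set ?_
  filter_upwards [compl_mem_ae_iff.2 hν] with p hp
  rw [compl_compl] at hp
  exact propext ⟨fun h => h.1, fun h => ⟨h, hp, fun h' => notMem_frontier_of_mem_isOpen hΩ h h'.1⟩⟩

theorem restrict_interiorPairs_map_snd (hΩ : IsOpen Ω) (hν : ν (closure Ω ×ˢ closure Ω)ᶜ = 0) :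
    ((ν.restrict (interiorPairs Ω)).map Prod.snd).restrict Ω = (ν.map Prod.snd).restrict Ω := by
  rw [Measure.restrict_map measurable_snd hΩ.measurableSet,
    Measure.restrict_map measurable_snd hΩ.measurableSet,
    Measure.restrict_restrict (measurable_snd hΩ.measurableSet)]
  congr 1
  refine Measure.restrict_congr_set ?_
  filter_upwards [compl_mem_ae_iff.2 hν] with p hp
  rw [compl_compl] at hp
  exact propext ⟨fun h => h.1, fun h => ⟨h, hp, fun h' => notMem_frontier_of_mem_isOpen hΩ h h'.2⟩⟩

end

/-! ### Cyclical monotonicity of optimal plans -/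

/-- A pair is chargeable by `γ` when each of its neighbourhoods within its stratum carries a
probability measure whose part in `interiorPairs Ω` is dominated by a multiple of `γ`. Pairs of
boundary points are always chargeable. -/
def IsChargeable {d : ℕ} (Ω : Set (Space d)) (γ : Measure (Space d × Space d))
    (p : Space d × Space d) : Prop :=
  ∀ G ∈ 𝓝[stratum Ω p.1 ×ˢ stratum Ω p.2] p, ∃ P : Measure (Space d × Space d),
    IsProbabilityMeasure P ∧ (∀ᵐ q ∂P, q ∈ G) ∧
      ∃ c : NNReal, P.restrict (interiorPairs Ω) ≤ c • γ

section

variable {d : ℕ} {Ω : Set (Space d)} {Ψ : Space d → ℝ} {τ : ℝ}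

theorem restrict_interiorPairs_dirac {p : Space d × Space d} (h1 : p.1 ∈ frontier Ω)
    (h2 : p.2 ∈ frontier Ω) : (Measure.dirac p).restrict (interiorPairs Ω) = 0 := by
  rw [Measure.restrict_eq_zero, Measure.dirac_apply' _ measurableSet_interiorPairs,
    indicator_of_notMem fun h => h.2 ⟨h1, h2⟩]

theorem isChargeable_of_frontier (hΩ : IsOpen Ω) {γ : Measure (Space d × Space d)}
    {p : Space d × Space d} (h1 : p.1 ∈ frontier Ω) (h2 : p.2 ∈ frontier Ω) :
    IsChargeable Ω γ p := by
  intro G hG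
  have hp : p ∈ stratum Ω p.1 ×ˢ stratum Ω p.2 :=
    ⟨mem_stratum hΩ (frontier_subset_closure h1), mem_stratum hΩ (frontier_subset_closure h2)⟩
  refine ⟨Measure.dirac p, inferInstance, ?_, 0, ?_⟩
  · rw [ae_dirac_eq]
    exact eventually_pure.2 (mem_of_mem_nhdsWithin hp hG)
  · rw [restrict_interiorPairs_dirac h1 h2]
    exact Measure.zero_le _

theorem isChargeable_of_pos (hΩ : IsOpen Ω) {γ : Measure (Space d × Space d)} [IsFiniteMeasure γ]
    {p : Space d × Space d} (hpos : ∀ G ∈ 𝓝[stratum Ω p.1 ×ˢ stratum Ω p.2] p, 0 < γ G) :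
    IsChargeable Ω γ p := by
  intro G hG
  obtain ⟨O, hO, hpO, hOG⟩ := mem_nhdsWithin.1 hG
  set G' := O ∩ stratum Ω p.1 ×ˢ stratum Ω p.2
  have hG'm : MeasurableSet G' :=
    hO.measurableSet.inter ((measurableSet_stratum hΩ).prod (measurableSet_stratum hΩ))
  have hG' : G' ∈ 𝓝[stratum Ω p.1 ×ˢ stratum Ω p.2] p :=
    mem_nhdsWithin.2 ⟨O, hO, hpO, subset_rfl⟩
  have h0 : γ G' ≠ 0 := (hpos G' hG').ne'
  refine ⟨ProbabilityTheory.cond γ G', ProbabilityTheory.cond_isProbabilityMeasure h0, ?_,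
    ((γ G')⁻¹).toNNReal, ?_⟩
  · filter_upwards [ProbabilityTheory.ae_cond_mem hG'm] with q hq using hOG hq
  · refine Measure.restrict_le_self.trans ?_
    rw [ProbabilityTheory.cond, ENNReal.smul_def, ENNReal.coe_toNNReal (ENNReal.inv_ne_top.2 h0)]
    gcongr
    exact Measure.restrict_le_self

theorem integral_le_of_ae_le {X : Type*} [MeasurableSpace X] {P : Measure X}
    [IsProbabilityMeasure P] {f : X → ℝ} (hf : Integrable f P) {a : ℝ} (h : ∀ᵐ x ∂P, f x ≤ a) :
    ∫ x, f x ∂P ≤ a := by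
  simpa using integral_mono_ae hf (integrable_const a) h

theorem le_integral_of_ae_le {X : Type*} [MeasurableSpace X] {P : Measure X}
    [IsProbabilityMeasure P] {f : X → ℝ} (hf : Integrable f P) {a : ℝ} (h : ∀ᵐ x ∂P, a ≤ f x) :
    a ≤ ∫ x, f x ∂P := by
  simpa using integral_mono_ae (integrable_const a) hf h

/-- A probability measure concentrated near `x` times one concentrated near `y` has cost at most
slightly larger than the cost of `(x, y)`. -/
theorem exists_nhds_integral_prod_le (hΩ : IsOpen Ω) (hb : Bornology.IsBounded Ω)
    (hΨ : ContinuousOn Ψ (closure Ω)) {x y : Space d} (hx : x ∈ closure Ω) (hy : y ∈ closure Ω)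
    {δ : ℝ} (hδ : 0 < δ) :
    ∃ U ∈ 𝓝[stratum Ω x] x, ∃ W ∈ 𝓝[stratum Ω y] y, MeasurableSet U ∧ MeasurableSet W ∧
      U ⊆ closure Ω ∧ W ⊆ closure Ω ∧
      ∀ P m : Measure (Space d), IsProbabilityMeasure P → IsProbabilityMeasure m →
        (∀ᵐ z ∂P, z ∈ U) → (∀ᵐ z ∂m, z ∈ W) →
        ∫ p, splitCost Ω Ψ τ p ∂(P.prod m) ≤ splitCost Ω Ψ τ (x, y) + δ := by
  have hcont := continuousOn_splitCost (τ := τ) hΩ hΨ x y (x, y)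
    ⟨mem_stratum hΩ hx, mem_stratum hΩ hy⟩
  have hev : ∀ᶠ p in 𝓝[stratum Ω x ×ˢ stratum Ω y] (x, y),
      splitCost Ω Ψ τ p < splitCost Ω Ψ τ (x, y) + δ :=
    hcont.eventually_lt_const (by linarith)
  rw [nhdsWithin_prod_eq] at hev
  obtain ⟨U, hU, W, hW, hUW⟩ := mem_prod_iff.1 hev
  obtain ⟨O, hO, hxO, hOU⟩ := mem_nhdsWithin.1 hU
  obtain ⟨Q, hQ, hyQ, hQW⟩ := mem_nhdsWithin.1 hW
  refine ⟨_, mem_nhdsWithin.2 ⟨O, hO, hxO, subset_rfl⟩, _,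
    mem_nhdsWithin.2 ⟨Q, hQ, hyQ, subset_rfl⟩, hO.measurableSet.inter (measurableSet_stratum hΩ),
    hQ.measurableSet.inter (measurableSet_stratum hΩ),
    inter_subset_right.trans stratum_subset_closure,
    inter_subset_right.trans stratum_subset_closure, ?_⟩
  intro P m hP hm hPU hmW
  refine integral_le_of_ae_le (integrable_splitCost hΩ hb hΨ _) ?_
  have h1 : ∀ᵐ p ∂(P.prod m), p.1 ∈ O ∩ stratum Ω x := Measure.quasiMeasurePreserving_fst.ae hPU
  have h2 : ∀ᵐ p ∂(P.prod m), p.2 ∈ Q ∩ stratum Ω y := Measure.quasiMeasurePreserving_snd.ae hmW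
  filter_upwards [h1, h2] with p hp1 hp2
  exact (hUW (show p ∈ U ×ˢ W from ⟨hOU hp1, hQW hp2⟩)).le

/-- A chain is realized, up to an arbitrarily small error, by a modification of the plan: the
removed mass `α` is dominated by a multiple of `γ`, the added mass `β` falls short of the marginals
of `α` by a unit mass at the base point and by a unit mass `m` near the end of the chain. -/
theorem exists_modification_of_costChain (hΩ : IsOpen Ω) (hb : Bornology.IsBounded Ω)
    (hΨ : ContinuousOn Ψ (closure Ω)) (γ : Measure (Space d × Space d)) (b : closure Ω)
    (hbf : (b : Space d) ∈ frontier Ω) {y : closure Ω} {V : ℝ}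
    (hc : CostChain (fun x y : closure Ω => splitCost Ω Ψ τ (x, y))
      {p | IsChargeable Ω γ (p.1, p.2)} b y V) :
    ∀ N ∈ 𝓝[stratum Ω (y : Space d)] (y : Space d), MeasurableSet N → ∀ δ > 0,
      ∃ (α β : Measure (Space d × Space d)) (m : Measure (Space d)),
        IsFiniteMeasure α ∧ IsFiniteMeasure β ∧ IsProbabilityMeasure m ∧ (∀ᵐ z ∂m, z ∈ N) ∧
        (∀ᵐ p ∂α, p ∈ closure Ω ×ˢ closure Ω) ∧ (∀ᵐ p ∂β, p ∈ closure Ω ×ˢ closure Ω) ∧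
        (∃ c : NNReal, α.restrict (interiorPairs Ω) ≤ c • γ) ∧
        β.map Prod.fst + Measure.dirac (b : Space d) = α.map Prod.fst ∧
        β.map Prod.snd + m = α.map Prod.snd ∧
        ∫ p, splitCost Ω Ψ τ p ∂β ≤ ∫ p, splitCost Ω Ψ τ p ∂α + V + δ := by
  induction hc with
  | base =>
    intro N hN hNm δ hδ
    refine ⟨Measure.dirac (b, b), 0, Measure.dirac b, inferInstance, inferInstance,
      inferInstance, ?_, ?_, by simp, ⟨0, ?_⟩, ?_, ?_, ?_⟩
    · rw [ae_dirac_eq]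
      exact eventually_pure.2 (mem_of_mem_nhdsWithin (mem_stratum hΩ b.2) hN)
    · rw [ae_dirac_eq]
      exact eventually_pure.2 ⟨b.2, b.2⟩
    · rw [restrict_interiorPairs_dirac hbf hbf]
      exact Measure.zero_le _
    · simp [Measure.map_dirac' measurable_fst]
    · simp [Measure.map_dirac' measurable_snd]
    · simp [splitCost_of_frontier_of_frontier hbf hbf, hδ.le]
  | @step y V x' y' hc hp ih =>
    intro N hN hNm δ hδ
    obtain ⟨U, hU, W, hW, hUm, hWm, hUc, hWc, hUW⟩ :=
      exists_nhds_integral_prod_le (τ := τ) hΩ hb hΨ x'.2 y.2 (show 0 < δ / 3 by linarith)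
    obtain ⟨α, β, m, hα, hβ, hm, hmW, hαc, hβc, ⟨c, hαγ⟩, hfst, hsnd, hcost⟩ :=
      ih W hW hWm (δ / 3) (by linarith)
    have hcont := continuousOn_splitCost (τ := τ) hΩ hΨ x' y' (x', y')
      ⟨mem_stratum hΩ x'.2, mem_stratum hΩ y'.2⟩
    have hev : ∀ᶠ p in 𝓝[stratum Ω (x' : Space d) ×ˢ stratum Ω (y' : Space d)]
        ((x' : Space d), (y' : Space d)),
        splitCost Ω Ψ τ (x', y') - δ / 3 < splitCost Ω Ψ τ p :=
      hcont.eventually_const_lt (by linarith)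
    have hUN : U ×ˢ N ∈ 𝓝[stratum Ω (x' : Space d) ×ˢ stratum Ω (y' : Space d)]
        ((x' : Space d), (y' : Space d)) := by
      rw [nhdsWithin_prod_eq]
      exact prod_mem_prod hU hN
    obtain ⟨P, hP, hPG, c', hPγ⟩ := hp _ (inter_mem (inter_mem hev hUN) self_mem_nhdsWithin)
    have hP1 : IsProbabilityMeasure (P.map Prod.fst) :=
      Measure.isProbabilityMeasure_map measurable_fst.aemeasurable
    have hP2 : IsProbabilityMeasure (P.map Prod.snd) :=
      Measure.isProbabilityMeasure_map measurable_snd.aemeasurable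
    have hPU : ∀ᵐ z ∂(P.map Prod.fst), z ∈ U := by
      refine (ae_map_iff (p := fun z => z ∈ U) measurable_fst.aemeasurable hUm).2 ?_
      filter_upwards [hPG] with q hq using hq.1.2.1
    have hPN : ∀ᵐ z ∂(P.map Prod.snd), z ∈ N := by
      refine (ae_map_iff (p := fun z => z ∈ N) measurable_snd.aemeasurable hNm).2 ?_
      filter_upwards [hPG] with q hq using hq.1.2.2
    refine ⟨α + P, β + (P.map Prod.fst).prod m, P.map Prod.snd, inferInstance, inferInstance,
      hP2, hPN, ?_, ?_, ⟨c + c', ?_⟩, ?_, ?_, ?_⟩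
    · rw [ae_add_measure_iff]
      refine ⟨hαc, ?_⟩
      filter_upwards [hPG] with q hq
      exact ⟨stratum_subset_closure hq.2.1, stratum_subset_closure hq.2.2⟩
    · rw [ae_add_measure_iff]
      refine ⟨hβc, ?_⟩
      have h1 : ∀ᵐ p ∂((P.map Prod.fst).prod m), p.1 ∈ U :=
        Measure.quasiMeasurePreserving_fst.ae hPU
      have h2 : ∀ᵐ p ∂((P.map Prod.fst).prod m), p.2 ∈ W :=
        Measure.quasiMeasurePreserving_snd.ae hmW
      filter_upwards [h1, h2] with p hp1 hp2 using ⟨hUc hp1, hWc hp2⟩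
    · rw [Measure.restrict_add, add_smul]
      exact add_le_add hαγ hPγ
    · rw [Measure.map_add _ _ measurable_fst, Measure.map_add _ _ measurable_fst, ← hfst,
        Measure.map_fst_prod, measure_univ, one_smul]
      abel
    · rw [Measure.map_add _ _ measurable_snd, Measure.map_add _ _ measurable_snd, ← hsnd,
        Measure.map_snd_prod, measure_univ, one_smul]
    · have hi : ∀ (ν : Measure (Space d × Space d)) [IsFiniteMeasure ν],
          Integrable (splitCost Ω Ψ τ) ν := fun ν _ => integrable_splitCost hΩ hb hΨ ν
      rw [integral_add_measure (hi _) (hi _), integral_add_measure (hi _) (hi _)]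
      have h1 := hUW (P.map Prod.fst) m hP1 hm hPU hmW
      have h2 : splitCost Ω Ψ τ (x', y') - δ / 3 ≤ ∫ p, splitCost Ω Ψ τ p ∂P := by
        refine le_integral_of_ae_le (hi P) ?_
        filter_upwards [hPG] with q hq using le_of_lt hq.1.1
      linarith

/-- The plan `γ` has the least transport cost among the finite plans on `closure Ω × closure Ω`
with the same marginals in `Ω`. -/
def IsTransportMinimal {d : ℕ} (Ω : Set (Space d)) (Ψ : Space d → ℝ) (τ : ℝ)
    (γ : Measure (Space d × Space d)) : Prop :=
  ∀ γ' : Measure (Space d × Space d), IsFiniteMeasure γ' → γ' (closure Ω ×ˢ closure Ω)ᶜ = 0 →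
    (γ'.map Prod.fst).restrict Ω = (γ.map Prod.fst).restrict Ω →
    (γ'.map Prod.snd).restrict Ω = (γ.map Prod.snd).restrict Ω →
    ∫ p, splitCost Ω Ψ τ p ∂γ ≤ ∫ p, splitCost Ω Ψ τ p ∂γ'

/-- Exchanging a part of a minimal plan for another plan with the same marginals does not lower
the cost. -/
theorem IsTransportMinimal.integral_le (hΩ : IsOpen Ω) (hb : Bornology.IsBounded Ω)
    (hΨ : ContinuousOn Ψ (closure Ω)) {γ α β : Measure (Space d × Space d)} [IsFiniteMeasure γ]
    (hγ : IsTransportMinimal Ω Ψ τ γ) (hγc : γ (closure Ω ×ˢ closure Ω)ᶜ = 0)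
    [IsFiniteMeasure α] [IsFiniteMeasure β]
    (hα : ∀ᵐ p ∂α, p ∈ closure Ω ×ˢ closure Ω) (hβ : ∀ᵐ p ∂β, p ∈ closure Ω ×ˢ closure Ω)
    {c : NNReal} (hαγ : α.restrict (interiorPairs Ω) ≤ c • γ)
    (hfst : β.map Prod.fst = α.map Prod.fst) (hsnd : β.map Prod.snd = α.map Prod.snd) :
    ∫ p, splitCost Ω Ψ τ p ∂α ≤ ∫ p, splitCost Ω Ψ τ p ∂β := by
  have hi : ∀ (ν : Measure (Space d × Space d)) [IsFiniteMeasure ν],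
      Integrable (splitCost Ω Ψ τ) ν := fun ν _ => integrable_splitCost hΩ hb hΨ ν
  set α' := α.restrict (interiorPairs Ω)
  -- the fraction of `α'` which can be removed from `γ`
  set ε : NNReal := (c + 1)⁻¹
  have hεpos : 0 < ε := by positivity
  have hεle : ε • α' ≤ γ := by
    calc ε • α' ≤ ε • c • γ := by gcongr
      _ = (ε * c) • γ := smul_smul _ _ _
      _ ≤ (1 : NNReal) • γ := by
        gcongr
        rw [inv_mul_le_iff₀ (by positivity)]
        simp
      _ = γ := one_smul _ _
  set κ := γ - ε • α'
  have hκ : κ + ε • α' = γ := Measure.sub_add_cancel_of_le hεle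
  have hκle : κ ≤ γ := Measure.sub_le
  have : IsFiniteMeasure κ := isFiniteMeasure_of_le γ hκle
  have hαc : α (closure Ω ×ˢ closure Ω)ᶜ = 0 := hα
  have key := hγ (κ + ε • β) inferInstance ?_ ?_ ?_
  · rw [integral_add_measure (hi _) (hi _), integral_smul_nnreal_measure] at key
    have h1 : ∫ p, splitCost Ω Ψ τ p ∂γ
        = ∫ p, splitCost Ω Ψ τ p ∂κ + ε • ∫ p, splitCost Ω Ψ τ p ∂α := by
      conv_lhs => rw [← hκ]
      rw [integral_add_measure (hi _) (hi _), integral_smul_nnreal_measure,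
        setIntegral_interiorPairs_splitCost]
    rw [h1] at key
    have h2 := le_of_add_le_add_left key
    exact le_of_smul_le_smul_left h2 hεpos
  · have h1 : κ (closure Ω ×ˢ closure Ω)ᶜ = 0 := nonpos_iff_eq_zero.1 ((hκle _).trans hγc.le)
    have h2 : β (closure Ω ×ˢ closure Ω)ᶜ = 0 := hβ
    simp [h1, h2]
  · conv_rhs => rw [← hκ]
    rw [Measure.map_add _ _ measurable_fst, Measure.map_add _ _ measurable_fst,
      Measure.restrict_add, Measure.restrict_add, Measure.map_smul, Measure.map_smul,
      Measure.restrict_smul, Measure.restrict_smul, restrict_interiorPairs_map_fst hΩ hαc, hfst]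
  · conv_rhs => rw [← hκ]
    rw [Measure.map_add _ _ measurable_snd, Measure.map_add _ _ measurable_snd,
      Measure.restrict_add, Measure.restrict_add, Measure.map_smul, Measure.map_smul,
      Measure.restrict_smul, Measure.restrict_smul, restrict_interiorPairs_map_snd hΩ hαc, hsnd]

/-- Chains of chargeable pairs issued from a boundary point cannot be closed up with a gain. -/
theorem IsTransportMinimal.costChain_nonneg (hΩ : IsOpen Ω) (hb : Bornology.IsBounded Ω)
    (hΨ : ContinuousOn Ψ (closure Ω)) {γ : Measure (Space d × Space d)} [IsFiniteMeasure γ]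
    (hγ : IsTransportMinimal Ω Ψ τ γ) (hγc : γ (closure Ω ×ˢ closure Ω)ᶜ = 0) (b : closure Ω)
    (hbf : (b : Space d) ∈ frontier Ω) (y : closure Ω) (V : ℝ)
    (hc : CostChain (fun x y : closure Ω => splitCost Ω Ψ τ (x, y))
      {p | IsChargeable Ω γ (p.1, p.2)} b y V) :
    0 ≤ V + splitCost Ω Ψ τ (b, y) := by
  refine le_of_forall_pos_le_add fun δ hδ => ?_
  obtain ⟨U, hU, W, hW, hUm, hWm, hUc, hWc, hUW⟩ :=
    exists_nhds_integral_prod_le (τ := τ) hΩ hb hΨ b.2 y.2 (show 0 < δ / 2 by linarith)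
  obtain ⟨α, β, m, hα, hβ, hm, hmW, hαc, hβc, ⟨c, hαγ⟩, hfst, hsnd, hcost⟩ :=
    exists_modification_of_costChain hΩ hb hΨ γ b hbf hc W hW hWm (δ / 2) (by linarith)
  have hbU : ∀ᵐ z ∂(Measure.dirac (b : Space d)), z ∈ U := by
    rw [ae_dirac_eq]
    exact eventually_pure.2 (mem_of_mem_nhdsWithin (mem_stratum hΩ b.2) hU)
  have h1 := hUW (Measure.dirac (b : Space d)) m inferInstance hm hbU hmW
  have h2 : ∀ᵐ p ∂(β + (Measure.dirac (b : Space d)).prod m), p ∈ closure Ω ×ˢ closure Ω := by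
    rw [ae_add_measure_iff]
    refine ⟨hβc, ?_⟩
    have h1 : ∀ᵐ p ∂((Measure.dirac (b : Space d)).prod m), p.1 ∈ U :=
      Measure.quasiMeasurePreserving_fst.ae hbU
    have h2 : ∀ᵐ p ∂((Measure.dirac (b : Space d)).prod m), p.2 ∈ W :=
      Measure.quasiMeasurePreserving_snd.ae hmW
    filter_upwards [h1, h2] with p hp1 hp2 using ⟨hUc hp1, hWc hp2⟩
  have h3 := hγ.integral_le hΩ hb hΨ hγc hαc h2 hαγ
    (by rw [Measure.map_add _ _ measurable_fst, ← hfst, Measure.map_fst_prod, measure_univ,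
      one_smul])
    (by rw [Measure.map_add _ _ measurable_snd, ← hsnd, Measure.map_snd_prod, measure_univ,
      one_smul])
  rw [integral_add_measure (integrable_splitCost hΩ hb hΨ _) (integrable_splitCost hΩ hb hΨ _)]
    at h3
  linarith

end

/-! ### Transforms, superdifferentials and supports -/

section

variable {d : ℕ} {Ω : Set (Space d)} {Ψ : Space d → ℝ} {τ : ℝ}

theorem frontier_nonempty_of_isBounded (hd : 1 ≤ d) (hb : Bornology.IsBounded Ω)
    (hne : Ω.Nonempty) : (frontier Ω).Nonempty := by
  by_contra h
  rw [not_nonempty_iff_eq_empty, frontier_eq_empty_iff] at h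
  have : Nontrivial (Space d) :=
    Module.nontrivial_of_finrank_pos (R := ℝ) (by rw [finrank_euclideanSpace_fin]; omega)
  rcases h with h | h
  · exact hne.ne_empty h
  · exact NormedSpace.unbounded_univ ℝ (Space d) (h ▸ hb)

theorem coe_eq_quadTransform {Y : Set (Space d)} {ψ : Space d → ℝ} {x : Space d} {r : ℝ}
    (h₁ : ∀ y ∈ Y, r ≤ ‖x - y‖ ^ 2 / (2 * τ) - ψ y)
    (h₂ : ∀ ε > 0, ∃ y ∈ Y, ‖x - y‖ ^ 2 / (2 * τ) - ψ y < r + ε) :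
    (r : EReal) = quadTransform τ Y (fun y => (ψ y : EReal)) x := by
  refine le_antisymm (le_iInf₂ fun y hy => ?_) (le_of_not_gt fun hlt => ?_)
  · change (r : EReal) ≤ _ - (ψ y : EReal)
    exact_mod_cast h₁ y hy
  · obtain ⟨s, hrs, hs⟩ := EReal.lt_iff_exists_real_btwn.1 hlt
    obtain ⟨y, hy, hlt'⟩ := h₂ (s - r) (sub_pos.2 (EReal.coe_lt_coe_iff.1 hrs))
    refine absurd (hs.trans_le (iInf₂_le y hy)) (not_lt.2 ?_)
    rw [← EReal.coe_sub, EReal.coe_le_coe_iff]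
    linarith

theorem le_of_coe_eq_quadTransform {Y : Set (Space d)} {ψ : Space d → ℝ} {x : Space d} {r : ℝ}
    (h : (r : EReal) = quadTransform τ Y (fun y => (ψ y : EReal)) x) {y : Space d} (hy : y ∈ Y) :
    r ≤ ‖x - y‖ ^ 2 / (2 * τ) - ψ y := by
  have h1 : (r : EReal) ≤ _ - (ψ y : EReal) := h.le.trans (iInf₂_le y hy)
  exact_mod_cast h1

/-- Real-valued form of membership in the superdifferential: `x ↦ c(x, p.2) - f x` is minimal on `X`
at `p.1`. -/
theorem mem_quadSuperdiff_iff {X Y : Set (Space d)} {f : Space d → ℝ} {p : Space d × Space d} :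
    p ∈ quadSuperdiff τ X Y f ↔ p.1 ∈ X ∧ p.2 ∈ Y ∧
      ∀ x ∈ X, ‖p.1 - p.2‖ ^ 2 / (2 * τ) - f p.1 ≤ ‖x - p.2‖ ^ 2 / (2 * τ) - f x := by
  refine and_congr_right fun h1 => and_congr_right fun _ => ⟨fun h x hx => ?_, fun h => ?_⟩
  · have hT : ((‖p.1 - p.2‖ ^ 2 / (2 * τ) - f p.1 : ℝ) : EReal)
        = quadTransform τ X (fun x => (f x : EReal)) p.2 := by
      rw [EReal.coe_sub, ← h, add_comm, EReal.add_sub_cancel_right]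
    have := le_of_coe_eq_quadTransform hT hx
    rwa [norm_sub_rev p.2 x] at this
  · rw [← coe_eq_quadTransform (r := ‖p.1 - p.2‖ ^ 2 / (2 * τ) - f p.1), ← EReal.coe_add]
    · congr 1; ring
    · intro x hx
      rw [norm_sub_rev p.2 x]
      exact h x hx
    · exact fun ε hε => ⟨p.1, h1, by rw [norm_sub_rev p.2 p.1]; linarith⟩

theorem stratum_mem {x : Space d} : stratum Ω x ∈ ({Ω, frontier Ω} : Set (Set (Space d))) := by
  unfold stratum
  split_ifs <;> simp

theorem eq_or_disjoint_of_strata (hΩ : IsOpen Ω) {A B : Set (Space d)}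
    (hA : A ∈ ({Ω, frontier Ω} : Set (Set (Space d))))
    (hB : B ∈ ({Ω, frontier Ω} : Set (Set (Space d)))) : A = B ∨ Disjoint A B := by
  have hdis : Disjoint Ω (frontier Ω) :=
    disjoint_left.2 fun _ hx => notMem_frontier_of_mem_isOpen hΩ hx
  rcases hA with rfl | rfl <;> rcases hB with rfl | rfl
  · exact Or.inl rfl
  · exact Or.inr hdis
  · exact Or.inr hdis.symm
  · exact Or.inl rfl

theorem isSplitOpen_inter (hΩ : IsOpen Ω) {O : Set (Space d × Space d)} (hO : IsOpen O)
    {A B : Set (Space d)} (hA : A ∈ ({Ω, frontier Ω} : Set (Set (Space d))))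
    (hB : B ∈ ({Ω, frontier Ω} : Set (Set (Space d)))) : IsSplitOpen Ω (O ∩ A ×ˢ B) := by
  have hcl : ∀ A ∈ ({Ω, frontier Ω} : Set (Set (Space d))), A ⊆ closure Ω := by
    rintro A (rfl | rfl)
    exacts [subset_closure, frontier_subset_closure]
  refine ⟨inter_subset_right.trans (prod_mono (hcl A hA) (hcl B hB)), fun A' hA' B' hB' => ?_⟩
  rcases eq_or_disjoint_of_strata hΩ hA hA' with rfl | h1
  · rcases eq_or_disjoint_of_strata hΩ hB hB' with rfl | h2
    · exact ⟨O, hO, by rw [inter_assoc, inter_self]⟩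
    · refine ⟨∅, isOpen_empty, ?_⟩
      rw [inter_assoc, Disjoint.inter_eq (h2.set_prod_right _ _)]
      simp
  · refine ⟨∅, isOpen_empty, ?_⟩
    rw [inter_assoc, Disjoint.inter_eq (h1.set_prod_left _ _)]
    simp

theorem measure_pos_of_mem_splitSupport (hΩ : IsOpen Ω) {ν : Measure (Space d × Space d)}
    {p : Space d × Space d} (hp : p ∈ splitSupport Ω ν) {G : Set (Space d × Space d)}
    (hG : G ∈ 𝓝[stratum Ω p.1 ×ˢ stratum Ω p.2] p) : 0 < ν G := by
  obtain ⟨O, hO, hpO, hOG⟩ := mem_nhdsWithin.1 hG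
  exact (hp.2 _ (isSplitOpen_inter hΩ hO stratum_mem stratum_mem)
    ⟨hpO, mem_stratum hΩ hp.1.1, mem_stratum hΩ hp.1.2⟩).trans_le (measure_mono hOG)

/-- The support of a measure for the disjoint union topology has full measure. -/
theorem ae_mem_splitSupport (hΩ : IsOpen Ω) {ν : Measure (Space d × Space d)}
    (hν : ν (closure Ω ×ˢ closure Ω)ᶜ = 0) : ∀ᵐ p ∂ν, p ∈ splitSupport Ω ν := by
  have key : ∀ A ∈ ({Ω, frontier Ω} : Set (Set (Space d))),
      ∀ B ∈ ({Ω, frontier Ω} : Set (Set (Space d))), MeasurableSet (A ×ˢ B) →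
      ∀ᵐ p ∂ν, p ∈ A ×ˢ B → p ∈ closure Ω ×ˢ closure Ω → p ∈ splitSupport Ω ν := by
    intro A hA B hB hm
    rw [← ae_restrict_iff' hm]
    have hs : ∀ᵐ p ∂(ν.restrict (A ×ˢ B)), p ∈ (ν.restrict (A ×ˢ B)).support :=
      Measure.support_mem_ae
    filter_upwards [hs, ae_restrict_mem hm] with p hp hpAB hpc
    refine ⟨hpc, fun G hG hpG => ?_⟩
    obtain ⟨O, hO, hGO⟩ := hG.2 A hA B hB
    have hpO : p ∈ O := by
      have : p ∈ O ∩ A ×ˢ B := hGO ▸ ⟨hpG, hpAB⟩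
      exact this.1
    have h1 := (Measure.mem_support_iff_forall p).1 hp O (hO.mem_nhds hpO)
    rw [Measure.restrict_apply hO.measurableSet, ← hGO] at h1
    exact h1.trans_le (measure_mono inter_subset_left)
  have hm₁ : MeasurableSet Ω := hΩ.measurableSet
  have hm₂ : MeasurableSet (frontier Ω) := isClosed_frontier.measurableSet
  have hc : ∀ᵐ p ∂ν, p ∈ closure Ω ×ˢ closure Ω := hν
  filter_upwards [hc, key Ω (by simp) Ω (by simp) (hm₁.prod hm₁),
    key Ω (by simp) (frontier Ω) (by simp) (hm₁.prod hm₂),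
    key (frontier Ω) (by simp) Ω (by simp) (hm₂.prod hm₁),
    key (frontier Ω) (by simp) (frontier Ω) (by simp) (hm₂.prod hm₂)] with p hpc h1 h2 h3 h4
  by_cases hp1 : p.1 ∈ Ω <;> by_cases hp2 : p.2 ∈ Ω
  · exact h1 ⟨hp1, hp2⟩ hpc
  · exact h2 ⟨hp1, mem_frontier_of_notMem hΩ hpc.2 hp2⟩ hpc
  · exact h3 ⟨mem_frontier_of_notMem hΩ hpc.1 hp1, hp2⟩ hpc
  · exact h4 ⟨mem_frontier_of_notMem hΩ hpc.1 hp1, mem_frontier_of_notMem hΩ hpc.2 hp2⟩ hpc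

/-! ### Existence of potentials -/

theorem planRestrict_left_le (hΩ : IsOpen Ω) (γ : Measure (Space d × Space d)) :
    planRestrict γ Ω (closure Ω) ≤ γ.restrict (interiorPairs Ω) :=
  Measure.restrict_mono_set γ fun _ hp => ⟨⟨subset_closure hp.1, hp.2⟩,
    fun h => notMem_frontier_of_mem_isOpen hΩ hp.1 h.1⟩

theorem planRestrict_right_le (hΩ : IsOpen Ω) (γ : Measure (Space d × Space d)) :
    planRestrict γ (closure Ω) Ω ≤ γ.restrict (interiorPairs Ω) :=
  Measure.restrict_mono_set γ fun _ hp => ⟨⟨hp.1, subset_closure hp.2⟩,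
    fun h => notMem_frontier_of_mem_isOpen hΩ hp.2 h.2⟩

theorem fst_mem_of_mem_splitSupport (hΩ : IsOpen Ω) {γ : Measure (Space d × Space d)}
    {p : Space d × Space d} (hp : p ∈ splitSupport Ω (planRestrict γ Ω (closure Ω))) :
    p.1 ∈ Ω := by
  by_contra h
  refine (measure_pos_of_mem_splitSupport hΩ hp self_mem_nhdsWithin).ne' ?_
  rw [planRestrict, Measure.restrict_apply' (hΩ.measurableSet.prod isClosed_closure.measurableSet)]
  convert measure_empty (μ := γ)
  refine eq_empty_of_forall_notMem fun q hq => ?_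
  have h1 := hq.1.1
  simp only [stratum, h, if_false] at h1
  exact notMem_frontier_of_mem_isOpen hΩ hq.2.1 h1

theorem snd_mem_of_mem_splitSupport (hΩ : IsOpen Ω) {γ : Measure (Space d × Space d)}
    {p : Space d × Space d} (hp : p ∈ splitSupport Ω (planRestrict γ (closure Ω) Ω)) :
    p.2 ∈ Ω := by
  by_contra h
  refine (measure_pos_of_mem_splitSupport hΩ hp self_mem_nhdsWithin).ne' ?_
  rw [planRestrict, Measure.restrict_apply' (isClosed_closure.measurableSet.prod hΩ.measurableSet)]
  convert measure_empty (μ := γ)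
  refine eq_empty_of_forall_notMem fun q hq => ?_
  have h1 := hq.1.2
  simp only [stratum, h, if_false] at h1
  exact notMem_frontier_of_mem_isOpen hΩ hq.2.2 h1

open Classical in
/-- A minimal plan admits a pair of potentials: the boundary pairs are added to the support of the
plan, so that the potentials given by Rockafellar's construction are constant on the boundary. -/
theorem exists_isPotentialPair (hΩ : IsOpen Ω) (hb : Bornology.IsBounded Ω)
    (hΨ : ContinuousOn Ψ (closure Ω)) (hfr : (frontier Ω).Nonempty)
    {γ : Measure (Space d × Space d)} [IsFiniteMeasure (γ.restrict (interiorPairs Ω))]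
    (hγ : IsTransportMinimal Ω Ψ τ (γ.restrict (interiorPairs Ω))) :
    ∃ φ φs : Space d → ℝ, IsPotentialPair Ω Ψ τ γ φ φs := by
  obtain ⟨b, hbf⟩ := hfr
  set γ₀ := γ.restrict (interiorPairs Ω) with hγ₀
  have hγ₀c : γ₀ (closure Ω ×ˢ closure Ω)ᶜ = 0 := by
    rw [hγ₀, Measure.restrict_apply'  measurableSet_interiorPairs]
    convert measure_empty (μ := γ)
    exact disjoint_iff_inter_eq_empty.1 (disjoint_compl_left_iff_subset.2 interiorPairs_subset)
  obtain ⟨M, hM⟩ := exists_abs_splitCost_le (τ := τ) hΩ hb hΨ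
  obtain ⟨f, g, hfg, hf, hg, hΓ, hfb⟩ := exists_conjugate_potentials
    (fun x y : closure Ω => splitCost Ω Ψ τ (x, y))
    {p : closure Ω × closure Ω | IsChargeable Ω γ₀ (p.1, p.2)} ⟨b, frontier_subset_closure hbf⟩
    (fun x y => hM _) (splitCost_of_frontier_of_frontier hbf hbf)
    (hγ.costChain_nonneg hΩ hb hΨ hγ₀c _ hbf)
  -- both potentials vanish on the boundary, because all boundary pairs are saturated
  have hg0 : ∀ y : closure Ω, (y : Space d) ∈ frontier Ω → g y = 0 := fun y hy => by
    have h1 := hΓ (⟨b, frontier_subset_closure hbf⟩, y) (isChargeable_of_frontier hΩ hbf hy)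
    dsimp only at h1
    rw [hfb, splitCost_of_frontier_of_frontier hbf hy] at h1
    linarith
  have hf0 : ∀ x : closure Ω, (x : Space d) ∈ frontier Ω → f x = 0 := fun x hx => by
    have h1 := hΓ (x, ⟨b, frontier_subset_closure hbf⟩) (isChargeable_of_frontier hΩ hx hbf)
    dsimp only at h1
    rw [hg0 _ hbf, splitCost_of_frontier_of_frontier hx hbf] at h1
    linarith
  let φ : Space d → ℝ := fun x => if h : x ∈ Ω then f ⟨x, subset_closure h⟩ else Ψ x
  let φs : Space d → ℝ := fun y => if h : y ∈ Ω then g ⟨y, subset_closure h⟩ else -Ψ y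
  have hφ : ∀ x (hx : x ∈ Ω), φ x = f ⟨x, subset_closure hx⟩ := fun x hx => dif_pos hx
  have hφs : ∀ y (hy : y ∈ Ω), φs y = g ⟨y, subset_closure hy⟩ := fun y hy => dif_pos hy
  have hφb : ∀ x ∈ frontier Ω, φ x = Ψ x := fun x hx =>
    dif_neg fun h => notMem_frontier_of_mem_isOpen hΩ h hx
  have hφsb : ∀ x ∈ frontier Ω, φs x = -Ψ x := fun x hx =>
    dif_neg fun h => notMem_frontier_of_mem_isOpen hΩ h hx
  -- the slack of the constraint is the same for `φ, φs` and for `f, g`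
  have hslack : ∀ x y : closure Ω, ((x : Space d) ∈ Ω ∨ (y : Space d) ∈ Ω) →
      ‖(x : Space d) - y‖ ^ 2 / (2 * τ) - φ x - φs y = splitCost Ω Ψ τ (x, y) - f x - g y := by
    rintro ⟨x, hx⟩ ⟨y, hy⟩ hxy
    dsimp only at hxy ⊢
    by_cases hxΩ : x ∈ Ω <;> by_cases hyΩ : y ∈ Ω
    · rw [splitCost_of_mem_of_mem hΩ hxΩ hyΩ, hφ x hxΩ, hφs y hyΩ]
    · have hyf := mem_frontier_of_notMem hΩ hy hyΩ
      rw [splitCost_of_mem_of_frontier hΩ hxΩ hyf, hφ x hxΩ, hφsb y hyf, hg0 _ hyf]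
      ring
    · have hxf := mem_frontier_of_notMem hΩ hx hxΩ
      rw [splitCost_of_frontier_of_mem hΩ hxf hyΩ, hφb x hxf, hφs y hyΩ, hf0 _ hxf]
      ring
    · exact absurd hxy (by tauto)
  have htr : ∀ x ∈ Ω, (φ x : EReal)
      = quadTransform τ (closure Ω) (fun y => (φs y : EReal)) x := by
    intro x hx
    refine coe_eq_quadTransform (fun y hy => ?_) fun ε hε => ?_
    · have h1 := hslack ⟨x, subset_closure hx⟩ ⟨y, hy⟩ (Or.inl hx)
      have h2 := hfg ⟨x, subset_closure hx⟩ ⟨y, hy⟩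
      dsimp only at h1 h2
      linarith
    · obtain ⟨y, hy⟩ := hf ⟨x, subset_closure hx⟩ ε hε
      have h1 := hslack ⟨x, subset_closure hx⟩ y (Or.inl hx)
      dsimp only at h1 hy
      exact ⟨y, y.2, by linarith⟩
  have htrs : ∀ y ∈ Ω, (φs y : EReal)
      = quadTransform τ (closure Ω) (fun x => (φ x : EReal)) y := by
    intro y hy
    refine coe_eq_quadTransform (fun x hx => ?_) fun ε hε => ?_
    · have h1 := hslack ⟨x, hx⟩ ⟨y, subset_closure hy⟩ (Or.inr hy)
      have h2 := hfg ⟨x, hx⟩ ⟨y, subset_closure hy⟩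
      dsimp only at h1 h2
      rw [norm_sub_rev]
      linarith
    · obtain ⟨x, hx⟩ := hg ⟨y, subset_closure hy⟩ ε hε
      have h1 := hslack x ⟨y, subset_closure hy⟩ (Or.inr hy)
      dsimp only at h1 hx
      exact ⟨x, x.2, by rw [norm_sub_rev]; linarith⟩
  -- on the supports, the constraint is saturated by Rockafellar's construction
  have hcharge : ∀ {ν : Measure (Space d × Space d)}, ν ≤ γ₀ → ∀ p ∈ splitSupport Ω ν,
      IsChargeable Ω γ₀ p := fun hν p hp =>
    isChargeable_of_pos hΩ fun G hG =>
      (measure_pos_of_mem_splitSupport hΩ hp hG).trans_le (hν G)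
  refine ⟨φ, φs, ⟨_, htr⟩, htr, ⟨_, htrs⟩, htrs, ?_, ?_, hφb, hφsb⟩
  · intro p hp
    have hp1 := fst_mem_of_mem_splitSupport hΩ hp
    have h1 := hslack ⟨p.1, hp.1.1⟩ ⟨p.2, hp.1.2⟩ (Or.inl hp1)
    have h2 := hΓ (⟨p.1, hp.1.1⟩, ⟨p.2, hp.1.2⟩) (hcharge (planRestrict_left_le hΩ γ) p hp)
    refine mem_quadSuperdiff_iff.2 ⟨hp1, hp.1.2, fun x hx => ?_⟩
    have h3 := le_of_coe_eq_quadTransform (htr x hx) hp.1.2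
    dsimp only at h1 h2
    linarith
  · intro p hp
    have hp2 := snd_mem_of_mem_splitSupport hΩ hp
    have h1 := hslack ⟨p.1, hp.1.1⟩ ⟨p.2, hp.1.2⟩ (Or.inr hp2)
    have h2 := hΓ (⟨p.1, hp.1.1⟩, ⟨p.2, hp.1.2⟩) (hcharge (planRestrict_right_le hΩ γ) p hp)
    refine mem_quadSuperdiff_iff.2 ⟨hp2, hp.1.1, fun y hy => ?_⟩
    have h3 := le_of_coe_eq_quadTransform (htrs y hy) hp.1.1
    dsimp only [Prod.fst_swap, Prod.snd_swap] at h1 h2 ⊢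
    rw [norm_sub_rev p.2 p.1]
    linarith

theorem IsPotentialPair.ae_mem_quadSuperdiff (hΩ : IsOpen Ω) {γ : Measure (Space d × Space d)}
    {φ φs : Space d → ℝ} (h : IsPotentialPair Ω Ψ τ γ φ φs)
    (hγ : γ (closure Ω ×ˢ closure Ω)ᶜ = 0) :
    ∀ᵐ p ∂(planRestrict γ Ω (closure Ω)), p ∈ quadSuperdiff τ Ω (closure Ω) φ := by
  have h0 : planRestrict γ Ω (closure Ω) (closure Ω ×ˢ closure Ω)ᶜ = 0 :=
    nonpos_iff_eq_zero.1 ((Measure.restrict_le_self _).trans hγ.le)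
  exact (ae_mem_splitSupport hΩ h0).mono fun p hp => h.support_subset hp

theorem IsPotentialPair.ae_mem_quadSuperdiff_star (hΩ : IsOpen Ω)
    {γ : Measure (Space d × Space d)} {φ φs : Space d → ℝ} (h : IsPotentialPair Ω Ψ τ γ φ φs)
    (hγ : γ (closure Ω ×ˢ closure Ω)ᶜ = 0) :
    ∀ᵐ p ∂((planRestrict γ (closure Ω) Ω).map Prod.swap),
      p ∈ quadSuperdiff τ Ω (closure Ω) φs := by
  have h0 : planRestrict γ (closure Ω) Ω (closure Ω ×ˢ closure Ω)ᶜ = 0 :=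
    nonpos_iff_eq_zero.1 ((Measure.restrict_le_self _).trans hγ.le)
  refine (MeasurableEquiv.prodComm.measurableEmbedding.ae_map_iff
    (μ := planRestrict γ (closure Ω) Ω)).2 ?_
  exact (ae_mem_splitSupport hΩ h0).mono fun p hp => h.support_subset_star hp

/-- Potentials are bounded above, by comparison with one boundary point. -/
theorem exists_le_of_eq_quadTransform (hΩ : IsOpen Ω) (hb : Bornology.IsBounded Ω)
    (hfr : (frontier Ω).Nonempty) {φ φs χ : Space d → ℝ} (hχ : ContinuousOn χ (closure Ω))
    (hφ : ∀ x ∈ Ω, (φ x : EReal) = quadTransform τ (closure Ω) (fun y => (φs y : EReal)) x)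
    (hφχ : ∀ x ∈ frontier Ω, φ x = χ x) : ∃ M, ∀ x ∈ closure Ω, φ x ≤ M := by
  obtain ⟨b, hbf⟩ := hfr
  have hcomp : IsCompact (closure Ω) := hb.isCompact_closure
  obtain ⟨M₁, hM₁⟩ := hcomp.exists_bound_of_continuousOn hχ
  obtain ⟨M₂, hM₂⟩ := hcomp.exists_bound_of_continuousOn
    (f := fun x : Space d => ‖x - b‖ ^ 2 / (2 * τ)) (by fun_prop)
  refine ⟨max M₁ (M₂ - φs b), fun x hx => ?_⟩
  by_cases hxΩ : x ∈ Ω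
  · have h1 := le_of_coe_eq_quadTransform (hφ x hxΩ) (frontier_subset_closure hbf)
    have h2 := (abs_le.1 (hM₂ x hx)).2
    exact le_max_of_le_right (by linarith)
  · rw [hφχ x (mem_frontier_of_notMem hΩ hx hxΩ)]
    exact le_max_of_le_left (abs_le.1 (hM₁ x hx)).2

end

/-! ### Potentials and gradients of convex functions -/

section

variable {d : ℕ} {Ω : Set (Space d)} {τ : ℝ}

/-- A transform over a bounded set is, up to the quadratic term `‖x‖² / (2τ)` and the factor
`-1 / τ`, a supremum of affine functions. It is therefore differentiable a.e. by Rademacher's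
theorem. -/
theorem exists_convex_gradient_of_eq_quadTransform (hΩ : IsOpen Ω) (hb : Bornology.IsBounded Ω)
    (hne : Ω.Nonempty) (hτ : 0 < τ) {φ ψ : Space d → ℝ}
    (hφ : ∀ x ∈ Ω, (φ x : EReal) = quadTransform τ (closure Ω) (fun y => (ψ y : EReal)) x)
    {M : ℝ} (hM : ∀ y ∈ closure Ω, ψ y ≤ M) :
    ∃ (u : Space d → ℝ) (G : Space d → Space d), ConvexOn ℝ univ u ∧ Measurable G ∧
      ∀ᵐ x ∂(volume.restrict Ω),
        HasGradientAt u (G x) x ∧ HasGradientAt φ (τ⁻¹ • (x - G x)) x := by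
  obtain ⟨R, hR⟩ := hb.closure.exists_norm_le
  have hR0 : 0 ≤ R := (norm_nonneg _).trans (hR _ (subset_closure hne.some_mem))
  have : Nonempty (closure Ω) := ⟨⟨_, subset_closure hne.some_mem⟩⟩
  let k : closure Ω → ℝ := fun y => τ * ψ y - ‖(y : Space d)‖ ^ 2 / 2
  let u : Space d → ℝ := fun x => ⨆ y : closure Ω, (inner ℝ x (y : Space d) + k y)
  have hinner : ∀ (x : Space d) (y : closure Ω), inner ℝ x (y : Space d) ≤ R * ‖x‖ := fun x y =>
    (real_inner_le_norm _ _).trans (by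
      rw [mul_comm]; exact mul_le_mul_of_nonneg_right (hR y y.2) (norm_nonneg _))
  have hbdd : ∀ x, BddAbove (range fun y : closure Ω => inner ℝ x (y : Space d) + k y) := by
    intro x
    refine ⟨R * ‖x‖ + τ * M, ?_⟩
    rintro r ⟨y, rfl⟩
    have h1 := hinner x y
    have h2 : τ * ψ y ≤ τ * M := mul_le_mul_of_nonneg_left (hM y y.2) hτ.le
    have h3 : 0 ≤ ‖(y : Space d)‖ ^ 2 := by positivity
    simp only [k]
    linarith
  have hle : ∀ x (y : closure Ω), inner ℝ x (y : Space d) + k y ≤ u x := fun x y =>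
    le_ciSup (hbdd x) y
  have hconv : ConvexOn ℝ univ u := by
    refine ⟨convex_univ, fun x _ z _ a c ha hc hac => ciSup_le fun y => ?_⟩
    have h1 := mul_le_mul_of_nonneg_left (hle x y) ha
    have h2 := mul_le_mul_of_nonneg_left (hle z y) hc
    have h3 : k y = a * k y + c * k y := by rw [← add_mul, hac, one_mul]
    rw [inner_add_left, real_inner_smul_left, real_inner_smul_left, smul_eq_mul, smul_eq_mul]
    linarith
  have hlip : LipschitzWith R.toNNReal u := by
    refine LipschitzWith.of_le_add_mul _ fun x z => ciSup_le fun y => ?_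
    have h1 := hle z y
    have h2 := hinner (x - z) y
    rw [inner_sub_left] at h2
    rw [dist_eq_norm, Real.coe_toNNReal _ hR0]
    linarith
  -- `φ` in terms of `u`
  have hsq : ∀ x y : Space d, ‖x - y‖ ^ 2 / (2 * τ)
      = τ⁻¹ * (‖x‖ ^ 2 / 2) - τ⁻¹ * (inner ℝ x y - ‖y‖ ^ 2 / 2) := fun x y => by
    rw [norm_sub_sq_real]
    field_simp
    ring
  have hφu : ∀ x ∈ Ω, φ x = τ⁻¹ * (‖x‖ ^ 2 / 2 - u x) := by
    intro x hx
    refine le_antisymm ?_ ?_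
    · have : u x ≤ ‖x‖ ^ 2 / 2 - τ * φ x := by
        refine ciSup_le fun y => ?_
        have h1 := le_of_coe_eq_quadTransform (hφ x hx) y.2
        rw [hsq] at h1
        have h2 := mul_le_mul_of_nonneg_left h1 hτ.le
        have h3 : τ * (τ⁻¹ * (‖x‖ ^ 2 / 2) - τ⁻¹ * (inner ℝ x (y : Space d)
            - ‖(y : Space d)‖ ^ 2 / 2) - ψ y)
            = ‖x‖ ^ 2 / 2 - inner ℝ x (y : Space d) + ‖(y : Space d)‖ ^ 2 / 2 - τ * ψ y := by
          field_simp
          ring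
        simp only [k]
        linarith
      rw [le_inv_mul_iff₀ hτ]
      linarith
    · rw [← EReal.coe_le_coe_iff, hφ x hx]
      refine le_iInf₂ fun y hy => ?_
      rw [← EReal.coe_sub, EReal.coe_le_coe_iff, hsq]
      have h1 := hle x ⟨y, hy⟩
      have h2 := mul_le_mul_of_nonneg_left h1 (inv_pos.2 hτ).le
      simp only [k] at h2
      have h3 : τ⁻¹ * (inner ℝ x y + (τ * ψ y - ‖y‖ ^ 2 / 2))
          = τ⁻¹ * (inner ℝ x y - ‖y‖ ^ 2 / 2) + ψ y := by
        field_simp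
        ring
      linarith
  refine ⟨u, gradient u, hconv, ?_, ?_⟩
  · exact (LinearIsometryEquiv.continuous _).measurable.comp (measurable_fderiv ℝ u)
  · have hae : ∀ᵐ x ∂(volume.restrict Ω), DifferentiableAt ℝ u x :=
      ae_restrict_of_ae hlip.ae_differentiableAt
    filter_upwards [hae, ae_restrict_mem hΩ.measurableSet] with x hx hxΩ
    have hg := hx.hasGradientAt
    refine ⟨hg, ?_⟩
    rw [hasGradientAt_iff_hasFDerivAt] at hg ⊢
    have h1 : HasFDerivAt (fun z : Space d => τ⁻¹ * (‖z‖ ^ 2 / 2 - u z))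
        (InnerProductSpace.toDual ℝ (Space d) (τ⁻¹ • (x - gradient u x))) x := by
      have h2 := (((hasStrictFDerivAt_norm_sq x).hasFDerivAt.mul_const (2⁻¹ : ℝ)).sub hg).const_mul
        τ⁻¹
      refine (h2.congr_fderiv ?_)
      ext w
      simp
    exact h1.congr_of_eventuallyEq ((hΩ.mem_nhds hxΩ |> eventually_of_mem) hφu)

/-- At a point of differentiability the superdifferential contains at most one point. -/
theorem snd_eq_of_mem_quadSuperdiff (hΩ : IsOpen Ω) (hτ : 0 < τ) {Y : Set (Space d)}
    {φ : Space d → ℝ} {p : Space d × Space d} {w : Space d} (hp : p ∈ quadSuperdiff τ Ω Y φ)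
    (hw : HasGradientAt φ (τ⁻¹ • (p.1 - w)) p.1) : p.2 = w := by
  obtain ⟨hp1, -, hmin⟩ := mem_quadSuperdiff_iff.1 hp
  have hloc : IsLocalMin (fun x => ‖x - p.2‖ ^ 2 / (2 * τ) - φ x) p.1 :=
    eventually_of_mem (hΩ.mem_nhds hp1) hmin
  rw [hasGradientAt_iff_hasFDerivAt] at hw
  have h1 : HasFDerivAt (fun x : Space d => ‖x - p.2‖ ^ 2 / (2 * τ) - φ x)
      (InnerProductSpace.toDual ℝ (Space d) (τ⁻¹ • (w - p.2))) p.1 := by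
    have h2 := (((hasFDerivAt_id p.1).sub_const p.2).norm_sq.mul_const ((2 * τ)⁻¹)).sub hw
    refine h2.congr_fderiv ?_
    ext z
    simp
    field_simp
    ring
  have h3 := hloc.hasFDerivAt_eq_zero h1
  rw [map_eq_zero_iff _ (InnerProductSpace.toDual ℝ (Space d)).injective, smul_eq_zero,
    sub_eq_zero] at h3
  exact (h3.resolve_left (inv_pos.2 hτ).ne').symm

/-- A plan whose pairs lie a.e. on a graph is the image of its first marginal under the graph
map. -/
theorem eq_map_graph {ν : Measure (Space d × Space d)} {T : Space d → Space d}
    (hT : Measurable T) (h : ∀ᵐ p ∂ν, p.2 = T p.1) :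
    ν = (ν.map Prod.fst).map fun x => (x, T x) := by
  rw [Measure.map_map (by fun_prop) measurable_fst]
  conv_lhs => rw [← Measure.map_id (μ := ν)]
  exact Measure.map_congr (h.mono fun p hp => Prod.ext rfl hp)

theorem ae_snd_eq_of_ae_mem_quadSuperdiff (hΩ : IsOpen Ω) (hτ : 0 < τ) {Y : Set (Space d)}
    {φ : Space d → ℝ} {G : Space d → Space d} {ν : Measure (Space d × Space d)}
    (hac : ν.map Prod.fst ≪ volume.restrict Ω)
    (hG : ∀ᵐ x ∂(volume.restrict Ω), HasGradientAt φ (τ⁻¹ • (x - G x)) x)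
    (hν : ∀ᵐ p ∂ν, p ∈ quadSuperdiff τ Ω Y φ) : ∀ᵐ p ∂ν, p.2 = G p.1 := by
  have h1 : ∀ᵐ p ∂ν, HasGradientAt φ (τ⁻¹ • (p.1 - G p.1)) p.1 :=
    ae_of_ae_map measurable_fst.aemeasurable (hac.ae_le hG)
  filter_upwards [h1, hν] with p hp hpν using snd_eq_of_mem_quadSuperdiff hΩ hτ hpν hp

/-- A plan concentrated on the superdifferential of a transform is induced by a map. -/
theorem exists_transport_map (hΩ : IsOpen Ω) (hb : Bornology.IsBounded Ω)
    (hne : Ω.Nonempty) (hτ : 0 < τ) {φ ψ : Space d → ℝ}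
    (hφ : ∀ x ∈ Ω, (φ x : EReal) = quadTransform τ (closure Ω) (fun y => (ψ y : EReal)) x)
    {M : ℝ} (hM : ∀ y ∈ closure Ω, ψ y ≤ M) {ν : Measure (Space d × Space d)}
    (hac : ν.map Prod.fst ≪ volume.restrict Ω) (hac' : volume.restrict Ω ≪ ν.map Prod.fst)
    (hν : ∀ᵐ p ∂ν, p ∈ quadSuperdiff τ Ω (closure Ω) φ) :
    ∃ T : Space d → Space d, Measurable T ∧ MapsTo T Ω (closure Ω) ∧
      ν = (ν.map Prod.fst).map (fun x => (x, T x)) ∧ IsConvexGradientOn Ω T := by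
  classical
  obtain ⟨u, G, hu, hGm, hG⟩ := exists_convex_gradient_of_eq_quadTransform hΩ hb hne hτ hφ hM
  have hgraph := ae_snd_eq_of_ae_mem_quadSuperdiff hΩ hτ hac (hG.mono fun x hx => hx.2) hν
  have hcl : MeasurableSet (G ⁻¹' closure Ω) := hGm isClosed_closure.measurableSet
  have hGcl : ∀ᵐ x ∂(volume.restrict Ω), G x ∈ closure Ω := by
    refine hac'.ae_le ((ae_map_iff measurable_fst.aemeasurable hcl).2 ?_)
    filter_upwards [hgraph, hν] with p hp hpν
    exact hp ▸ hpν.2.1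
  let T : Space d → Space d := fun x => if x ∈ G ⁻¹' closure Ω then G x else hne.some
  have hTm : Measurable T := Measurable.ite hcl hGm measurable_const
  have hTG : ∀ᵐ x ∂(volume.restrict Ω), G x = T x := hGcl.mono fun x hx => (if_pos hx).symm
  have hTG' : ∀ᵐ p ∂ν, G p.1 = T p.1 :=
    ae_of_ae_map measurable_fst.aemeasurable (hac.ae_le hTG)
  refine ⟨T, hTm, fun x _ => ?_, eq_map_graph hTm ?_, u, hu, ?_⟩
  · by_cases h : x ∈ G ⁻¹' closure Ω
    · rwa [show T x = G x from if_pos h]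
    · rw [show T x = hne.some from if_neg h]
      exact subset_closure hne.some_mem
  · filter_upwards [hgraph, hTG'] with p h1 h2 using h1.trans h2
  · filter_upwards [hG, hTG] with x h1 h2 using h2 ▸ h1.1

/-- The gradient of a transform is prescribed by any map whose graph lies in its
superdifferential. -/
theorem ae_gradient_eq_of_transport_map (hΩ : IsOpen Ω) (hb : Bornology.IsBounded Ω)
    (hne : Ω.Nonempty) (hτ : 0 < τ) {φ ψ : Space d → ℝ}
    (hφ : ∀ x ∈ Ω, (φ x : EReal) = quadTransform τ (closure Ω) (fun y => (ψ y : EReal)) x)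
    {M : ℝ} (hM : ∀ y ∈ closure Ω, ψ y ≤ M) {ν : Measure (Space d × Space d)}
    (hac : ν.map Prod.fst ≪ volume.restrict Ω) (hac' : volume.restrict Ω ≪ ν.map Prod.fst)
    (hν : ∀ᵐ p ∂ν, p ∈ quadSuperdiff τ Ω (closure Ω) φ) {T : Space d → Space d}
    (hT : Measurable T) (hνT : ν = (ν.map Prod.fst).map fun x => (x, T x)) :
    ∀ᵐ x ∂(volume.restrict Ω),
      DifferentiableAt ℝ φ x ∧ -gradient φ x = τ⁻¹ • (T x - x) := by
  obtain ⟨u, G, hu, hGm, hG⟩ := exists_convex_gradient_of_eq_quadTransform hΩ hb hne hτ hφ hM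
  have hgraph := ae_snd_eq_of_ae_mem_quadSuperdiff hΩ hτ hac (hG.mono fun x hx => hx.2) hν
  rw [hνT] at hgraph
  have hTG : ∀ᵐ x ∂(volume.restrict Ω), T x = G x :=
    hac'.ae_le (ae_of_ae_map (f := fun x => (x, T x)) (by fun_prop) hgraph)
  filter_upwards [hG, hTG] with x h1 h2
  refine ⟨h1.2.differentiableAt, ?_⟩
  rw [h1.2.gradient, h2, ← smul_neg, neg_sub]

/-- Two plans with the same first marginal, both concentrated on the superdifferential of a
transform, coincide. -/
theorem eq_of_ae_mem_quadSuperdiff (hΩ : IsOpen Ω) (hb : Bornology.IsBounded Ω)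
    (hne : Ω.Nonempty) (hτ : 0 < τ) {φ ψ : Space d → ℝ}
    (hφ : ∀ x ∈ Ω, (φ x : EReal) = quadTransform τ (closure Ω) (fun y => (ψ y : EReal)) x)
    {M : ℝ} (hM : ∀ y ∈ closure Ω, ψ y ≤ M) {ν ν' : Measure (Space d × Space d)}
    (heq : ν.map Prod.fst = ν'.map Prod.fst) (hac : ν.map Prod.fst ≪ volume.restrict Ω)
    (hν : ∀ᵐ p ∂ν, p ∈ quadSuperdiff τ Ω (closure Ω) φ)
    (hν' : ∀ᵐ p ∂ν', p ∈ quadSuperdiff τ Ω (closure Ω) φ) : ν = ν' := by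
  obtain ⟨u, G, hu, hGm, hG⟩ := exists_convex_gradient_of_eq_quadTransform hΩ hb hne hτ hφ hM
  have hG' := hG.mono fun x hx => hx.2
  rw [eq_map_graph hGm (ae_snd_eq_of_ae_mem_quadSuperdiff hΩ hτ hac hG' hν),
    eq_map_graph hGm (ae_snd_eq_of_ae_mem_quadSuperdiff hΩ hτ (heq ▸ hac) hG' hν'), heq]

end

/-! ### The reaction energy -/

section

variable {d : ℕ} {Ω : Set (Space d)} {Ψ : Space d → ℝ} {e : ℝ → Space d → EReal}

theorem CostData.bot_lt (he : CostData Ω Ψ e) (z : ℝ) {x : Space d} (hx : x ∈ closure Ω) :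
    ⊥ < e z x := by
  obtain ⟨C, hC⟩ := he.superlinear 0
  exact (EReal.bot_lt_coe _).trans_le (hC z x hx)

theorem CostData.coe_toReal (he : CostData Ω Ψ e) {z : ℝ} {x : Space d} (hx : x ∈ closure Ω)
    (hz : e z x < ⊤) : ((e z x).toReal : EReal) = e z x :=
  EReal.coe_toReal hz.ne (he.bot_lt z hx).ne'

theorem CostData.lt_top_of_lt {a : EReal}
    (ha : ∀ x ∈ Ω, finiteDomainAt e x = {z : ℝ | a < (z : EReal)}) {z : ℝ} {x : Space d}
    (hx : x ∈ Ω) (hz : a < z) : e z x < ⊤ := by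
  have h1 : z ∈ finiteDomainAt e x := by rw [ha x hx]; exact hz
  exact interior_subset (s := {z | e z x < ⊤}) h1

open Classical in
/-- A convex lower semicontinuous function on the line is right continuous along its domain; its
values are limits of values at interior points of the domain. -/
theorem CostData.tendsto_right (he : CostData Ω Ψ e) {a : EReal} (ha' : a < ⊤)
    (ha : ∀ x ∈ Ω, finiteDomainAt e x = {z : ℝ | a < (z : EReal)}) (z : ℝ) {x : Space d}
    (hx : x ∈ Ω) :
    Tendsto (fun n : ℕ => if a < ((z + 1 / ((n : ℝ) + 1) : ℝ) : EReal)
      then e (z + 1 / ((n : ℝ) + 1)) x else ⊤) atTop (𝓝 (e z x)) := by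
  have hxc := subset_closure hx
  have hlim : Tendsto (fun n : ℕ => 1 / ((n : ℝ) + 1)) atTop (𝓝 0) :=
    tendsto_one_div_add_atTop_nhds_zero_nat
  have hz : Tendsto (fun n : ℕ => z + 1 / ((n : ℝ) + 1)) atTop (𝓝 z) := by
    simpa using hlim.const_add z
  refine tendsto_order.2 ⟨fun c hc => ?_, fun c hc => ?_⟩
  · filter_upwards [hz.eventually (he.lsc x hxc z c hc)] with n hn
    split_ifs
    · exact hn
    · exact hc.trans_le le_top
  · have hfin : e z x < ⊤ := hc.trans_le le_top
    -- compare with the chord from `z` to an interior point `w > z` of the domain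
    obtain ⟨w, hzw, haw⟩ : ∃ w : ℝ, z < w ∧ a < w := by
      obtain ⟨w₀, hw₀, -⟩ := EReal.lt_iff_exists_real_btwn.1 ha'
      refine ⟨max (z + 1) w₀, by simp, hw₀.trans_le ?_⟩
      exact EReal.coe_le_coe_iff.2 (le_max_right _ _)
    have hwfin : e w x < ⊤ := CostData.lt_top_of_lt ha hx haw
    set t : ℕ → ℝ := fun n => (1 / ((n : ℝ) + 1)) / (w - z)
    have ht : Tendsto t atTop (𝓝 0) := by
      simpa only [zero_div] using hlim.div_const (w - z)
    have hbound : Tendsto (fun n => (1 - t n) * (e z x).toReal + t n * (e w x).toReal) atTop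
        (𝓝 (e z x).toReal) := by
      simpa using (((tendsto_const_nhds (x := (1 : ℝ))).sub ht).mul_const (e z x).toReal).add
        (ht.mul_const (e w x).toReal)
    have hev : ∀ᶠ n in atTop,
        (((1 - t n) * (e z x).toReal + t n * (e w x).toReal : ℝ) : EReal) < c := by
      refine ((continuous_coe_real_ereal.tendsto _).comp hbound).eventually_lt_const ?_
      rwa [he.coe_toReal hxc hfin]
    filter_upwards [hev, ht.eventually_lt_const one_pos] with n hn htn
    have htpos : 0 < t n := div_pos (by positivity) (by linarith)
    have hcomb : (1 - t n) • z + t n • w = z + 1 / ((n : ℝ) + 1) := by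
      have : t n * (w - z) = 1 / ((n : ℝ) + 1) := div_mul_cancel₀ _ (by linarith)
      simp only [smul_eq_mul]
      linarith
    have hint : z + 1 / ((n : ℝ) + 1) ∈ finiteDomainAt e x := by
      refine (he.strictConvex x hxc).1.openSegment_self_interior_subset_interior
        (x := z) (y := w) hfin ?_ ⟨1 - t n, t n, by linarith, htpos, by ring, hcomb⟩
      change w ∈ finiteDomainAt e x
      rw [ha x hx]
      exact haw
    have hlt : a < ((z + 1 / ((n : ℝ) + 1) : ℝ) : EReal) := by
      rw [ha x hx] at hint
      exact hint
    rw [if_pos hlt, ← he.coe_toReal hxc (CostData.lt_top_of_lt ha hx hlt)]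
    refine lt_of_le_of_lt (EReal.coe_le_coe_iff.2 ?_) hn
    have := (he.strictConvex x hxc).convexOn.2 (x := z) hfin (y := w) hwfin
      (by linarith : 0 ≤ 1 - t n) htpos.le (by ring)
    rwa [hcomb] at this

/-- The reaction cost is continuous on the interior of its domain, and its values elsewhere are
limits of values in the interior. -/
theorem CostData.aemeasurable (he : CostData Ω Ψ e) (hΩ : IsOpen Ω) {h : Space d → ℝ}
    (hh : AEMeasurable h (volume.restrict Ω)) :
    AEMeasurable (fun x => e (h x) x) (volume.restrict Ω) := by
  classical
  obtain ⟨a, ha', ha⟩ := he.domain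
  set U : Set (ℝ × Space d) := {p | a < (p.1 : EReal) ∧ p.2 ∈ Ω}
  have hU : IsOpen U :=
    (isOpen_lt continuous_const (continuous_coe_real_ereal.comp continuous_fst)).inter
      (hΩ.preimage continuous_snd)
  have hUD : U ⊆ finiteDomain Ω e := fun p hp => ⟨subset_closure hp.2,
    mem_nhdsWithin_of_mem_nhds (mem_of_superset (hU.mem_nhds hp)
      fun q hq => CostData.lt_top_of_lt ha hq.2 hq.1)⟩
  have hcont : ContinuousOn (fun p : ℝ × Space d => ((e p.1 p.2).toReal : EReal)) U := by
    refine continuous_coe_real_ereal.comp_continuousOn fun p hp => ?_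
    obtain ⟨K, hK, hpK, hKU⟩ := exists_compact_subset hU hp
    obtain ⟨L, hL⟩ := he.locallyLipschitz K hK (hKU.trans hUD)
    exact (hL.continuousOn.continuousAt (mem_interior_iff_mem_nhds.1 hpK)).continuousWithinAt
  have hF : Measurable (U.piecewise (fun p : ℝ × Space d => ((e p.1 p.2).toReal : EReal))
      fun _ => ⊤) :=
    hcont.measurable_piecewise continuousOn_const hU.measurableSet
  refine aemeasurable_of_tendsto_metrizable_ae atTop (f := fun (n : ℕ) x =>
    U.piecewise (fun p : ℝ × Space d => ((e p.1 p.2).toReal : EReal)) (fun _ => ⊤)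
      (h x + 1 / ((n : ℝ) + 1), x)) (fun n => ?_) ?_
  · exact hF.comp_aemeasurable ((hh.add_const _).prodMk aemeasurable_id)
  · filter_upwards [ae_restrict_mem hΩ.measurableSet] with x hx
    refine (he.tendsto_right ha' ha (h x) hx).congr fun n => ?_
    by_cases hn : a < ((h x + 1 / ((n : ℝ) + 1) : ℝ) : EReal)
    · rw [if_pos hn, piecewise_eq_of_mem _ _ _ (show (h x + 1 / ((n : ℝ) + 1), x) ∈ U from ⟨hn, hx⟩),
        he.coe_toReal (subset_closure hx) (CostData.lt_top_of_lt ha hx hn)]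
    · rw [if_neg hn, piecewise_eq_of_notMem _ _ _
        (show (h x + 1 / ((n : ℝ) + 1), x) ∉ U from fun h => hn h.1)]

theorem CostData.lintegral_neg_ne_top (he : CostData Ω Ψ e) (hΩ : IsOpen Ω)
    (hb : Bornology.IsBounded Ω) (h : Space d → ℝ) :
    ∫⁻ x in Ω, (-(e (h x) x)).toENNReal ≠ ⊤ := by
  obtain ⟨C, hC⟩ := he.superlinear 0
  refine ne_top_of_le_ne_top (b := ∫⁻ _ in Ω, ENNReal.ofReal (-C)) ?_ ?_
  · rw [setLIntegral_const]
    exact ENNReal.mul_ne_top ENNReal.ofReal_ne_top hb.measure_lt_top.ne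
  · refine lintegral_mono_ae ?_
    filter_upwards [ae_restrict_mem hΩ.measurableSet] with x hx
    rw [← EReal.real_coe_toENNReal, EReal.coe_neg]
    refine EReal.toENNReal_le_toENNReal (EReal.neg_le_neg_iff.2 ?_)
    have := hC (h x) x (subset_closure hx)
    simpa using this

theorem CostData.reactionEnergy_ne_bot (he : CostData Ω Ψ e) (hΩ : IsOpen Ω)
    (hb : Bornology.IsBounded Ω) (h : Space d → ℝ) : reactionEnergy Ω e h ≠ ⊥ := by
  have h1 := he.lintegral_neg_ne_top hΩ hb h
  unfold reactionEnergy
  rw [← EReal.coe_ennreal_toReal h1, sub_eq_add_neg, ← EReal.coe_neg]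
  exact EReal.add_ne_bot_iff.2 ⟨EReal.coe_ennreal_ne_bot _, EReal.coe_ne_bot _⟩

/-- When the reaction cost is finite a.e. and integrable, the reaction energy is its integral. -/
theorem CostData.reactionEnergy_eq_integral (he : CostData Ω Ψ e) (hΩ : IsOpen Ω)
    {h : Space d → ℝ}
    (hfin : ∀ᵐ x ∂(volume.restrict Ω), e (h x) x < ⊤)
    (hint : IntegrableOn (fun x => (e (h x) x).toReal) Ω) :
    reactionEnergy Ω e h = ((∫ x in Ω, (e (h x) x).toReal : ℝ) : EReal) := by
  have hcoe : ∀ᵐ x ∂(volume.restrict Ω), ((e (h x) x).toReal : EReal) = e (h x) x := by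
    filter_upwards [hfin, ae_restrict_mem hΩ.measurableSet] with x h1 h2
      using he.coe_toReal (subset_closure h2) h1
  have hpos : ∫⁻ x in Ω, (e (h x) x).toENNReal
      = ∫⁻ x in Ω, ENNReal.ofReal ((e (h x) x).toReal) :=
    lintegral_congr_ae (hfin.mono fun x hx => EReal.toENNReal_of_ne_top hx.ne)
  have hneg : ∫⁻ x in Ω, (-(e (h x) x)).toENNReal
      = ∫⁻ x in Ω, ENNReal.ofReal (-((e (h x) x).toReal)) := by
    refine lintegral_congr_ae (hcoe.mono fun x hx => ?_)
    dsimp only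
    rw [← hx, ← EReal.coe_neg, EReal.toENNReal_of_ne_top (EReal.coe_ne_top _), EReal.toReal_coe,
      EReal.toReal_coe]
  have h1 := hint.lintegral_lt_top
  have h2 : ∫⁻ x in Ω, ENNReal.ofReal (-((e (h x) x).toReal)) < ⊤ :=
    hint.neg.lintegral_lt_top
  rw [reactionEnergy, hpos, hneg, integral_eq_lintegral_pos_part_sub_lintegral_neg_part hint,
    EReal.coe_sub, EReal.coe_ennreal_toReal h1.ne, EReal.coe_ennreal_toReal h2.ne]

theorem CostData.integrable_of_reactionEnergy_ne_top (he : CostData Ω Ψ e) (hΩ : IsOpen Ω)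
    (hb : Bornology.IsBounded Ω) {h : Space d → ℝ} (hh : AEMeasurable h (volume.restrict Ω))
    (hE : reactionEnergy Ω e h ≠ ⊤) :
    (∀ᵐ x ∂(volume.restrict Ω), e (h x) x < ⊤) ∧
      IntegrableOn (fun x => (e (h x) x).toReal) Ω := by
  have hm := he.aemeasurable hΩ hh
  have hneg := he.lintegral_neg_ne_top hΩ hb h
  have hpos : ∫⁻ x in Ω, (e (h x) x).toENNReal ≠ ⊤ := by
    intro htop
    refine hE ?_
    rw [reactionEnergy, htop, EReal.coe_ennreal_top]
    exact EReal.top_sub fun h' => hneg (EReal.coe_ennreal_eq_top_iff.1 h')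
  have hfin : ∀ᵐ x ∂(volume.restrict Ω), e (h x) x < ⊤ := by
    filter_upwards [ae_lt_top' hm.ereal_toENNReal hpos] with x hx
    rw [lt_top_iff_ne_top]
    intro h'
    simp [h'] at hx
  refine ⟨hfin, hm.ereal_toReal.aestronglyMeasurable, ?_⟩
  rw [hasFiniteIntegral_iff_norm]
  refine lt_of_le_of_lt (lintegral_mono_ae (g := fun x => (e (h x) x).toENNReal
    + (-(e (h x) x)).toENNReal) ?_) ?_
  · filter_upwards [hfin, ae_restrict_mem hΩ.measurableSet] with x h1 h2
    rw [← he.coe_toReal (subset_closure h2) h1, ← EReal.coe_neg,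
      EReal.toENNReal_of_ne_top (EReal.coe_ne_top _),
      EReal.toENNReal_of_ne_top (EReal.coe_ne_top _), EReal.toReal_coe, EReal.toReal_coe,
      Real.norm_eq_abs]
    rcases abs_cases (e (h x) x).toReal with h | h
    · rw [h.1]; exact le_self_add
    · rw [h.1]; exact le_add_self
  · rw [lintegral_add_left' hm.ereal_toENNReal]
    exact ENNReal.add_lt_top.2 ⟨hpos.lt_top, hneg.lt_top⟩

/-- Midpoint convexity of the reaction energy, with the equality case given by strict convexity of
the reaction cost. -/
theorem CostData.reactionEnergy_midpoint (he : CostData Ω Ψ e) (hΩ : IsOpen Ω)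
    (hb : Bornology.IsBounded Ω) {h h' : Space d → ℝ} (hh : AEMeasurable h (volume.restrict Ω))
    (hh' : AEMeasurable h' (volume.restrict Ω)) (hE : reactionEnergy Ω e h ≠ ⊤)
    (hE' : reactionEnergy Ω e h' ≠ ⊤) :
    ∃ r r' s : ℝ, reactionEnergy Ω e h = r ∧ reactionEnergy Ω e h' = r' ∧
      reactionEnergy Ω e (fun x => (h x + h' x) / 2) = s ∧ s ≤ (r + r') / 2 ∧
      ((r + r') / 2 ≤ s → h' =ᵐ[volume.restrict Ω] h) := by
  obtain ⟨hf, hi⟩ := he.integrable_of_reactionEnergy_ne_top hΩ hb hh hE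
  obtain ⟨hf', hi'⟩ := he.integrable_of_reactionEnergy_ne_top hΩ hb hh' hE'
  have hmid : ∀ᵐ x ∂(volume.restrict Ω), e ((h x + h' x) / 2) x < ⊤ ∧
      (e ((h x + h' x) / 2) x).toReal ≤ ((e (h x) x).toReal + (e (h' x) x).toReal) / 2 ∧
      (h' x ≠ h x →
        (e ((h x + h' x) / 2) x).toReal < ((e (h x) x).toReal + (e (h' x) x).toReal) / 2) := by
    filter_upwards [hf, hf', ae_restrict_mem hΩ.measurableSet] with x h1 h2 hx
    have hc := he.strictConvex x (subset_closure hx)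
    have hco : (2⁻¹ : ℝ) • h x + (2⁻¹ : ℝ) • h' x = (h x + h' x) / 2 := by
      simp only [smul_eq_mul]; ring
    have half₀ : (0 : ℝ) < 2⁻¹ := by norm_num
    have half₁ : (2⁻¹ : ℝ) + 2⁻¹ = 1 := by norm_num
    have h3 := hc.1 h1 h2 half₀.le half₀.le half₁
    have h4 := hc.convexOn.2 h1 h2 half₀.le half₀.le half₁
    rw [hco] at h3 h4
    refine ⟨h3, ?_, fun hne => ?_⟩
    · simp only [smul_eq_mul] at h4
      linarith
    · have h5 := hc.2 h1 h2 hne.symm half₀ half₀ half₁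
      rw [hco] at h5
      simp only [smul_eq_mul] at h5
      linarith
  have hsum : IntegrableOn (fun x => ((e (h x) x).toReal + (e (h' x) x).toReal) / 2) Ω :=
    (hi.add hi').div_const 2
  obtain ⟨C, hC⟩ := he.superlinear 0
  have him : IntegrableOn (fun x => (e ((h x + h' x) / 2) x).toReal) Ω := by
    have : IsFiniteMeasure (volume.restrict Ω) := ⟨by simpa using hb.measure_lt_top⟩
    refine Integrable.mono' (hsum.abs.add (integrable_const |C|))
      ((he.aemeasurable hΩ ((hh.add hh').div_const 2)).ereal_toReal.aestronglyMeasurable) ?_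
    filter_upwards [hmid, ae_restrict_mem hΩ.measurableSet] with x hm hx
    have h1 : C ≤ (e ((h x + h' x) / 2) x).toReal := by
      have := hC ((h x + h' x) / 2) x (subset_closure hx)
      rw [← he.coe_toReal (subset_closure hx) hm.1, EReal.coe_le_coe_iff] at this
      linarith
    simp only [Pi.add_apply, Real.norm_eq_abs]
    rw [abs_le]
    have h2 := neg_abs_le C
    have h3 := le_abs_self (((e (h x) x).toReal + (e (h' x) x).toReal) / 2)
    have h4 := abs_nonneg C
    have h5 := abs_nonneg (((e (h x) x).toReal + (e (h' x) x).toReal) / 2)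
    exact ⟨by linarith, by linarith [hm.2.1]⟩
  refine ⟨_, _, _, he.reactionEnergy_eq_integral hΩ hf hi,
    he.reactionEnergy_eq_integral hΩ hf' hi',
    he.reactionEnergy_eq_integral hΩ (hmid.mono fun x hx => hx.1) him, ?_, fun hle => ?_⟩
  · rw [← integral_add hi hi', ← integral_div]
    exact integral_mono_ae him hsum (hmid.mono fun x hx => hx.2.1)
  · rw [← integral_add hi hi', ← integral_div] at hle
    have heq := (integral_eq_iff_of_ae_le him hsum (hmid.mono fun x hx => hx.2.1)).1
      (le_antisymm (integral_mono_ae him hsum (hmid.mono fun x hx => hx.2.1)) hle)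
    filter_upwards [hmid, heq] with x hx hxe
    by_contra hne
    exact (hx.2.2 hne).ne hxe

end

/-! ### Admissible and optimal pairs -/

section

variable {d : ℕ} {Ω : Set (Space d)} {Ψ : Space d → ℝ} {e : ℝ → Space d → EReal} {τ : ℝ}
  {μ : Measure (Space d)} {ρ : Space d → ℝ}

theorem CostData.continuousOn (he : CostData Ω Ψ e) : ContinuousOn Ψ (closure Ω) :=
  he.lipschitz_bdry.choose_spec.continuousOn

theorem pairCost_eq (γ : Measure (Space d × Space d)) (h : Space d → ℝ) :
    pairCost Ω Ψ e τ γ h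
      = ((∫ p, splitCost Ω Ψ τ p ∂(γ.restrict (interiorPairs Ω)) : ℝ) : EReal)
        + (τ : EReal) * reactionEnergy Ω e h := by
  have h1 : ∫ p in interiorPairs Ω, splitCost Ω Ψ τ p ∂γ = ∫ p in interiorPairs Ω,
      (‖p.1 - p.2‖ ^ 2 / (2 * τ) + (Ω ×ˢ frontier Ω).indicator (fun q => Ψ q.2) p
        - (frontier Ω ×ˢ Ω).indicator (fun q => Ψ q.1) p) ∂γ :=
    setIntegral_congr_fun measurableSet_interiorPairs fun p hp => indicator_of_mem hp _
  rw [h1]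
  rfl

theorem isAdmissible_iff (hΩ : IsOpen Ω) {γ : Measure (Space d × Space d)} {h : Space d → ℝ} :
    IsAdmissible Ω τ μ ρ γ h ↔ γ (closure Ω ×ˢ closure Ω)ᶜ = 0 ∧ IntegrableOn h Ω ∧
      (∀ᵐ y ∂(volume.restrict Ω), 0 ≤ ρ y + τ * h y) ∧
      (γ.map Prod.snd).restrict Ω = targetMeasure Ω τ ρ h ∧
      (γ.map Prod.fst).restrict Ω = μ := by
  constructor
  · rintro ⟨h1, h2, h3, h4, h5⟩
    rw [planRestrict_map_snd hΩ h1] at h4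
    rw [planRestrict_map_fst hΩ h1] at h5
    exact ⟨h1, h2, h3, h4, h5⟩
  · rintro ⟨h1, h2, h3, h4, h5⟩
    rw [← planRestrict_map_snd hΩ h1] at h4
    rw [← planRestrict_map_fst hΩ h1] at h5
    exact ⟨h1, h2, h3, h4, h5⟩

theorem isFiniteMeasure_targetMeasure (hρ : IntegrableOn ρ Ω) {h : Space d → ℝ}
    (hh : IntegrableOn h Ω) : IsFiniteMeasure (targetMeasure Ω τ ρ h) :=
  isFiniteMeasure_withDensity_ofReal (hρ.add (hh.const_mul τ)).hasFiniteIntegral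

/-- An admissible plan may carry infinite mass on the pairs of boundary points, but its remaining
part is finite. -/
theorem IsAdmissible.isFiniteMeasure (hρ : IntegrableOn ρ Ω) [IsFiniteMeasure μ]
    (hΩ : IsOpen Ω) {γ : Measure (Space d × Space d)} {h : Space d → ℝ}
    (hγ : IsAdmissible Ω τ μ ρ γ h) : IsFiniteMeasure (γ.restrict (interiorPairs Ω)) := by
  have hm := isFiniteMeasure_targetMeasure (τ := τ) hρ hγ.integrable
  refine ⟨?_⟩
  have h1 : γ (Ω ×ˢ closure Ω) < ⊤ := by
    have := measure_lt_top μ univ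
    rwa [← hγ.fst_marginal, Measure.map_apply measurable_fst MeasurableSet.univ, preimage_univ,
      planRestrict, Measure.restrict_apply_univ] at this
  have h2 : γ (closure Ω ×ˢ Ω) < ⊤ := by
    have := measure_lt_top (targetMeasure Ω τ ρ h) univ
    rwa [← hγ.snd_marginal, Measure.map_apply measurable_snd MeasurableSet.univ, preimage_univ,
      planRestrict, Measure.restrict_apply_univ] at this
  rw [Measure.restrict_apply_univ]
  refine (measure_mono fun p hp => ?_).trans_lt
    ((measure_union_le _ _).trans_lt (ENNReal.add_lt_top.2 ⟨h1, h2⟩))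
  by_cases hp1 : p.1 ∈ Ω
  · exact Or.inl ⟨hp1, hp.1.2⟩
  · refine Or.inr ⟨hp.1.1, ?_⟩
    by_contra hp2
    exact hp.2 ⟨mem_frontier_of_notMem hΩ hp.1.1 hp1, mem_frontier_of_notMem hΩ hp.1.2 hp2⟩

/-- The pair that sends all of `μ` to a boundary point and takes all of `ρ dx` from it, without
reaction. -/
theorem isAdmissible_of_boundary_point (hΩ : IsOpen Ω) [IsFiniteMeasure μ]
    (hμ : μ ≪ volume.restrict Ω) (hρ : IntegrableOn ρ Ω)
    (hρ0 : ∀ᵐ y ∂(volume.restrict Ω), 0 ≤ ρ y) {b : Space d} (hb : b ∈ frontier Ω) :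
    IsAdmissible Ω τ μ ρ (μ.prod (Measure.dirac b)
      + (Measure.dirac b).prod (targetMeasure Ω τ ρ fun _ => 0)) fun _ => 0 := by
  have hm := isFiniteMeasure_targetMeasure (τ := τ) (h := fun _ => 0) hρ integrableOn_zero
  set ν := targetMeasure Ω τ ρ fun _ => 0 with hν
  have hμΩ : ∀ᵐ x ∂μ, x ∈ Ω := hμ.ae_le (ae_restrict_mem hΩ.measurableSet)
  have hνΩ : ∀ᵐ x ∂ν, x ∈ Ω :=
    (withDensity_absolutelyContinuous _ _).ae_le (ae_restrict_mem hΩ.measurableSet)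
  have hbc := frontier_subset_closure hb
  have hdir : (Measure.dirac b).restrict Ω = 0 := by
    rw [Measure.restrict_eq_zero, Measure.dirac_apply' _ hΩ.measurableSet,
      indicator_of_notMem fun h => notMem_frontier_of_mem_isOpen hΩ h hb]
  have hdirc : ∀ᵐ x ∂(Measure.dirac b), x ∈ closure Ω := by
    rw [ae_dirac_eq]
    exact eventually_pure.2 hbc
  refine (isAdmissible_iff hΩ).2 ⟨?_, integrableOn_zero, by simpa using hρ0, ?_, ?_⟩
  · change ∀ᵐ p ∂_, p ∈ closure Ω ×ˢ closure Ω
    rw [ae_add_measure_iff]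
    constructor
    · filter_upwards [Measure.quasiMeasurePreserving_fst.ae hμΩ,
        Measure.quasiMeasurePreserving_snd.ae hdirc] with p h1 h2 using ⟨subset_closure h1, h2⟩
    · filter_upwards [Measure.quasiMeasurePreserving_fst.ae hdirc,
        Measure.quasiMeasurePreserving_snd.ae hνΩ] with p h1 h2 using ⟨h1, subset_closure h2⟩
  · rw [Measure.map_add _ _ measurable_snd, Measure.map_snd_prod, Measure.map_snd_prod,
      Measure.restrict_add, Measure.restrict_smul, hdir, smul_zero, zero_add, measure_univ,
      one_smul, Measure.restrict_eq_self_of_ae_mem hνΩ]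
  · rw [Measure.map_add _ _ measurable_fst, Measure.map_fst_prod, Measure.map_fst_prod,
      Measure.restrict_add, Measure.restrict_smul, Measure.restrict_smul, hdir, smul_zero,
      add_zero, measure_univ, one_smul, Measure.restrict_eq_self_of_ae_mem hμΩ]

/-- Comparison with the pair of `isAdmissible_of_boundary_point`, whose reaction energy vanishes by
normalization. -/
theorem IsOptimalPair.reactionEnergy_ne_top (hΩ : IsOpen Ω) (hfr : (frontier Ω).Nonempty)
    (he : CostData Ω Ψ e) (hτ : 0 < τ) [IsFiniteMeasure μ]
    (hμ : μ ≪ volume.restrict Ω) (hρ : IntegrableOn ρ Ω)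
    (hρ0 : ∀ᵐ y ∂(volume.restrict Ω), 0 ≤ ρ y) {γ : Measure (Space d × Space d)}
    {h : Space d → ℝ} (hopt : IsOptimalPair Ω Ψ e τ μ ρ γ h) : reactionEnergy Ω e h ≠ ⊤ := by
  obtain ⟨b, hb⟩ := hfr
  intro htop
  have h1 := hopt.2 _ _ (isAdmissible_of_boundary_point (τ := τ) hΩ hμ hρ hρ0 hb)
  rw [pairCost_eq, pairCost_eq, he.normalized, mul_zero, add_zero, htop,
    EReal.coe_mul_top_of_pos hτ, EReal.add_top_of_ne_bot (EReal.coe_ne_bot _)] at h1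
  exact EReal.coe_ne_top _ (top_le_iff.1 h1)

theorem pairCost_eq_coe {γ : Measure (Space d × Space d)} {h : Space d → ℝ} {r : ℝ}
    (hr : reactionEnergy Ω e h = r) :
    pairCost Ω Ψ e τ γ h
      = ((∫ p, splitCost Ω Ψ τ p ∂(γ.restrict (interiorPairs Ω)) + τ * r : ℝ) : EReal) := by
  rw [pairCost_eq, hr, EReal.coe_add, EReal.coe_mul]

/-- For an optimal pair, the plan is minimal among the plans with the same marginals. -/
theorem IsOptimalPair.isTransportMinimal (hΩ : IsOpen Ω) (hb : Bornology.IsBounded Ω)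
    (he : CostData Ω Ψ e)
    {γ : Measure (Space d × Space d)} {h : Space d → ℝ} (hopt : IsOptimalPair Ω Ψ e τ μ ρ γ h)
    (hE : reactionEnergy Ω e h ≠ ⊤) :
    IsTransportMinimal Ω Ψ τ (γ.restrict (interiorPairs Ω)) := by
  intro γ' _ hγ' hfst hsnd
  obtain ⟨r, hr⟩ : ∃ r : ℝ, reactionEnergy Ω e h = r :=
    ⟨_, (EReal.coe_toReal hE (he.reactionEnergy_ne_bot hΩ hb h)).symm⟩
  obtain ⟨h1, h2, h3, h4, h5⟩ := (isAdmissible_iff hΩ).1 hopt.1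
  rw [restrict_interiorPairs_map_fst hΩ h1, h5] at hfst
  rw [restrict_interiorPairs_map_snd hΩ h1, h4] at hsnd
  have key := hopt.2 γ' h ((isAdmissible_iff hΩ).2 ⟨hγ', h2, h3, hsnd, hfst⟩)
  rw [pairCost_eq_coe hr, pairCost_eq_coe hr, EReal.coe_le_coe_iff,
    setIntegral_interiorPairs_splitCost γ'] at key
  linarith

/-- Half the sum of two plans. -/
noncomputable def midPlan (γ γ' : Measure (Space d × Space d)) : Measure (Space d × Space d) :=
  (2⁻¹ : NNReal) • (γ + γ')

theorem half_smul_add_self {X : Type*} [MeasurableSpace X] (ν : Measure X) :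
    (2⁻¹ : NNReal) • (ν + ν) = ν := by
  rw [← two_smul NNReal ν, smul_smul, inv_mul_cancel₀ two_ne_zero, one_smul]

theorem targetMeasure_midpoint (hρ : IntegrableOn ρ Ω) {h h' : Space d → ℝ}
    (hh : IntegrableOn h Ω)
    (h0 : ∀ᵐ y ∂(volume.restrict Ω), 0 ≤ ρ y + τ * h y)
    (h0' : ∀ᵐ y ∂(volume.restrict Ω), 0 ≤ ρ y + τ * h' y) :
    (2⁻¹ : NNReal) • (targetMeasure Ω τ ρ h + targetMeasure Ω τ ρ h')
      = targetMeasure Ω τ ρ fun x => (h x + h' x) / 2 := by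
  have hae : (fun y => ENNReal.ofReal (ρ y + τ * ((h y + h' y) / 2)))
      =ᵐ[volume.restrict Ω] ((2⁻¹ : NNReal) : ENNReal) • fun y =>
        ENNReal.ofReal (ρ y + τ * h y) + ENNReal.ofReal (ρ y + τ * h' y) := by
    filter_upwards [h0, h0'] with y hy hy'
    rw [Pi.smul_apply, smul_eq_mul, ← ENNReal.ofReal_add hy hy', ← ENNReal.ofReal_coe_nnreal,
      ← ENNReal.ofReal_mul (NNReal.coe_nonneg _), NNReal.coe_inv, NNReal.coe_ofNat]
    congr 1
    ring
  rw [targetMeasure, targetMeasure, targetMeasure, withDensity_congr_ae hae,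
    withDensity_smul' _ _ ENNReal.coe_ne_top, ENNReal.smul_def]
  congr 1
  ext s hs
  have hm : AEMeasurable (fun y => ENNReal.ofReal (ρ y + τ * h y)) (volume.restrict Ω) :=
    (hρ.add (hh.const_mul τ)).aemeasurable.ennreal_ofReal
  rw [Measure.add_apply, withDensity_apply _ hs, withDensity_apply _ hs, withDensity_apply _ hs,
    lintegral_add_left' hm.restrict]

theorem IsAdmissible.midpoint (hΩ : IsOpen Ω) (hρ : IntegrableOn ρ Ω)
    {γ γ' : Measure (Space d × Space d)} {h h' : Space d → ℝ}
    (hγ : IsAdmissible Ω τ μ ρ γ h) (hγ' : IsAdmissible Ω τ μ ρ γ' h') :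
    IsAdmissible Ω τ μ ρ (midPlan γ γ') fun x => (h x + h' x) / 2 := by
  obtain ⟨h1, h2, h3, h4, h5⟩ := (isAdmissible_iff hΩ).1 hγ
  obtain ⟨h1', h2', h3', h4', h5'⟩ := (isAdmissible_iff hΩ).1 hγ'
  refine (isAdmissible_iff hΩ).2 ⟨?_, (h2.add h2').div_const 2, ?_, ?_, ?_⟩
  · simp [midPlan, h1, h1']
  · filter_upwards [h3, h3'] with y hy hy'
    linarith
  · rw [midPlan, Measure.map_smul, Measure.map_add _ _ measurable_snd, Measure.restrict_smul,
      Measure.restrict_add, h4, h4', targetMeasure_midpoint hρ h2 h3 h3']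
  · rw [midPlan, Measure.map_smul, Measure.map_add _ _ measurable_fst, Measure.restrict_smul,
      Measure.restrict_add, h5, h5', half_smul_add_self]

theorem integral_midPlan (hΩ : IsOpen Ω) (hb : Bornology.IsBounded Ω)
    (hΨ : ContinuousOn Ψ (closure Ω)) (γ γ' : Measure (Space d × Space d))
    [IsFiniteMeasure (γ.restrict (interiorPairs Ω))]
    [IsFiniteMeasure (γ'.restrict (interiorPairs Ω))] :
    ∫ p, splitCost Ω Ψ τ p ∂((midPlan γ γ').restrict (interiorPairs Ω))
      = (∫ p, splitCost Ω Ψ τ p ∂(γ.restrict (interiorPairs Ω))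
        + ∫ p, splitCost Ω Ψ τ p ∂(γ'.restrict (interiorPairs Ω))) / 2 := by
  rw [midPlan, Measure.restrict_smul, Measure.restrict_add, integral_smul_nnreal_measure,
    integral_add_measure (integrable_splitCost hΩ hb hΨ _) (integrable_splitCost hΩ hb hΨ _),
    NNReal.smul_def, smul_eq_mul, NNReal.coe_inv, NNReal.coe_ofNat]
  ring

/-- The midpoint of two optimal pairs is optimal, and their reaction terms agree a.e. -/
theorem IsOptimalPair.midpoint (hΩ : IsOpen Ω) (hb : Bornology.IsBounded Ω)
    (hfr : (frontier Ω).Nonempty) (he : CostData Ω Ψ e) (hτ : 0 < τ) [IsFiniteMeasure μ]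
    (hμ : μ ≪ volume.restrict Ω) (hρ : IntegrableOn ρ Ω)
    (hρ0 : ∀ᵐ y ∂(volume.restrict Ω), 0 ≤ ρ y) {γ γ' : Measure (Space d × Space d)}
    {h h' : Space d → ℝ} (hopt : IsOptimalPair Ω Ψ e τ μ ρ γ h)
    (hopt' : IsOptimalPair Ω Ψ e τ μ ρ γ' h') :
    IsOptimalPair Ω Ψ e τ μ ρ (midPlan γ γ') (fun x => (h x + h' x) / 2) ∧
      h' =ᵐ[volume.restrict Ω] h := by
  have hE := hopt.reactionEnergy_ne_top hΩ hfr he hτ hμ hρ hρ0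
  have hE' := hopt'.reactionEnergy_ne_top hΩ hfr he hτ hμ hρ hρ0
  obtain ⟨r, r', s, hr, hr', hs, hle, hstrict⟩ := he.reactionEnergy_midpoint hΩ hb
    hopt.1.integrable.aemeasurable hopt'.1.integrable.aemeasurable hE hE'
  have := hopt.1.isFiniteMeasure hρ hΩ
  have := hopt'.1.isFiniteMeasure hρ hΩ
  have hadm := hopt.1.midpoint hΩ hρ hopt'.1
  have h1 := hopt.2 _ _ hopt'.1
  have h2 := hopt'.2 _ _ hopt.1
  have h3 := hopt.2 _ _ hadm
  have hmid := integral_midPlan (τ := τ) hΩ hb he.continuousOn γ γ'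
  rw [pairCost_eq_coe hr, pairCost_eq_coe hr', EReal.coe_le_coe_iff] at h1
  rw [pairCost_eq_coe hr, pairCost_eq_coe hr', EReal.coe_le_coe_iff] at h2
  rw [pairCost_eq_coe hr, pairCost_eq_coe hs, EReal.coe_le_coe_iff, hmid] at h3
  refine ⟨⟨hadm, fun γ'' h'' hadm'' => ?_⟩, hstrict ?_⟩
  · refine le_trans ?_ (hopt.2 _ _ hadm'')
    rw [pairCost_eq_coe hr, pairCost_eq_coe hs, EReal.coe_le_coe_iff, hmid]
    have := mul_le_mul_of_nonneg_left hle hτ.le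
    linarith
  · refine le_of_mul_le_mul_left ?_ hτ
    linarith

theorem IsOptimalPair.exists_isPotentialPair (hΩ : IsOpen Ω) (hb : Bornology.IsBounded Ω)
    (hfr : (frontier Ω).Nonempty) (he : CostData Ω Ψ e) (hτ : 0 < τ) [IsFiniteMeasure μ]
    (hμ : μ ≪ volume.restrict Ω) (hρ : IntegrableOn ρ Ω)
    (hρ0 : ∀ᵐ y ∂(volume.restrict Ω), 0 ≤ ρ y) {γ : Measure (Space d × Space d)}
    {h : Space d → ℝ} (hopt : IsOptimalPair Ω Ψ e τ μ ρ γ h) :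
    ∃ φ φs : Space d → ℝ, IsPotentialPair Ω Ψ τ γ φ φs := by
  have := hopt.1.isFiniteMeasure hρ hΩ
  exact _root_.exists_isPotentialPair hΩ hb he.continuousOn hfr (hopt.isTransportMinimal hΩ hb he
    (hopt.reactionEnergy_ne_top hΩ hfr he hτ hμ hρ hρ0))

theorem ae_planRestrict_midPlan {γ γ' : Measure (Space d × Space d)} {A B : Set (Space d)}
    {q : Space d × Space d → Prop} (h : ∀ᵐ p ∂(planRestrict (midPlan γ γ') A B), q p) :
    (∀ᵐ p ∂(planRestrict γ A B), q p) ∧ ∀ᵐ p ∂(planRestrict γ' A B), q p := by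
  rw [planRestrict, midPlan, Measure.restrict_smul, Measure.restrict_add,
    Measure.ae_smul_measure_iff (by norm_num), ae_add_measure_iff] at h
  exact h

/-- A plan without mass on the pairs of boundary points is determined by its restrictions to
`Ω × closure Ω` and to `closure Ω × Ω`. -/
theorem eq_of_planRestrict_eq (hΩ : IsOpen Ω) {γ γ' : Measure (Space d × Space d)}
    (hc : γ (closure Ω ×ˢ closure Ω)ᶜ = 0) (hc' : γ' (closure Ω ×ˢ closure Ω)ᶜ = 0)
    (hf : γ (frontier Ω ×ˢ frontier Ω) = 0) (hf' : γ' (frontier Ω ×ˢ frontier Ω) = 0)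
    (h1 : planRestrict γ' Ω (closure Ω) = planRestrict γ Ω (closure Ω))
    (h2 : planRestrict γ' (closure Ω) Ω = planRestrict γ (closure Ω) Ω) : γ' = γ := by
  have hm : MeasurableSet (frontier Ω ×ˢ Ω) :=
    isClosed_frontier.measurableSet.prod hΩ.measurableSet
  have hdis : Disjoint (Ω ×ˢ closure Ω) (frontier Ω ×ˢ Ω) :=
    (disjoint_left.2 fun _ hx => notMem_frontier_of_mem_isOpen hΩ hx).set_prod_left _ _
  have key : ∀ η : Measure (Space d × Space d), η (closure Ω ×ˢ closure Ω)ᶜ = 0 →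
      η (frontier Ω ×ˢ frontier Ω) = 0 →
      η = planRestrict η Ω (closure Ω)
        + (planRestrict η (closure Ω) Ω).restrict (frontier Ω ×ˢ Ω) := by
    intro η hη hηf
    rw [planRestrict, planRestrict, Measure.restrict_restrict hm,
      inter_eq_left.2 (prod_mono frontier_subset_closure subset_rfl),
      ← Measure.restrict_union hdis hm]
    refine (Measure.restrict_eq_self_of_ae_mem ?_).symm
    have hη' : ∀ᵐ p ∂η, p ∈ closure Ω ×ˢ closure Ω := hη
    have hηf' : ∀ᵐ p ∂η, p ∉ frontier Ω ×ˢ frontier Ω := measure_eq_zero_iff_ae_notMem.1 hηf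
    filter_upwards [hη', hηf'] with p hp hpf
    by_cases hp1 : p.1 ∈ Ω
    · exact Or.inl ⟨hp1, hp.2⟩
    · refine Or.inr ⟨mem_frontier_of_notMem hΩ hp.1 hp1, ?_⟩
      by_contra hp2
      exact hpf ⟨mem_frontier_of_notMem hΩ hp.1 hp1, mem_frontier_of_notMem hΩ hp.2 hp2⟩
  rw [key γ hc hf, key γ' hc' hf', h1, h2]

end

/-! ### Uniqueness of optimal pairs -/

theorem mainTheorem4 {d : ℕ} (hd : 1 ≤ d)
    (Ω : Set (Space d)) (hΩ_open : IsOpen Ω) (hΩ_bdd : Bornology.IsBounded Ω)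
    (hΩ_ne : Ω.Nonempty)
    (Ψ : Space d → ℝ) (e : ℝ → Space d → EReal) (hcost : CostData Ω Ψ e)
    (τ : ℝ) (hτ : 0 < τ)
    (μ : Measure (Space d)) (hμ_fin : IsFiniteMeasure μ) (hμ_ac : μ ≪ volume.restrict Ω)
    (ρ : Space d → ℝ) (hρ_int : IntegrableOn ρ Ω)
    (hρ_nonneg : ∀ᵐ y ∂(volume.restrict Ω), 0 ≤ ρ y)
    (γ : Measure (Space d × Space d)) (h : Space d → ℝ)
    (hopt : IsOptimalPair Ω Ψ e τ μ ρ γ h)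
    (hμ_pos : volume.restrict Ω ≪ μ)
    (hν_pos : ∀ᵐ y ∂(volume.restrict Ω), 0 < ρ y + τ * h y) :
    (∀ γ' h', IsOptimalPair Ω Ψ e τ μ ρ γ' h' → h' =ᵐ[volume.restrict Ω] h) ∧
    (∃ φ φs : Space d → ℝ, IsPotentialPair Ω Ψ τ γ φ φs) ∧
    ((∀ γ' h', IsOptimalPair Ω Ψ e τ μ ρ γ' h' →
        planRestrict γ' Ω (closure Ω) = planRestrict γ Ω (closure Ω)) ∧
      ∃ T : Space d → Space d, Measurable T ∧ MapsTo T Ω (closure Ω) ∧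
        planRestrict γ Ω (closure Ω) = μ.map (fun x => (x, T x)) ∧
        IsConvexGradientOn Ω T ∧
        ∀ φ φs : Space d → ℝ, IsPotentialPair Ω Ψ τ γ φ φs →
          ∀ᵐ x ∂(volume.restrict Ω),
            DifferentiableAt ℝ φ x ∧ -gradient φ x = τ⁻¹ • (T x - x)) ∧
    ((∀ γ' h', IsOptimalPair Ω Ψ e τ μ ρ γ' h' →
        planRestrict γ' (closure Ω) Ω = planRestrict γ (closure Ω) Ω) ∧
      ∃ S : Space d → Space d, Measurable S ∧ MapsTo S Ω (closure Ω) ∧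
        planRestrict γ (closure Ω) Ω = (targetMeasure Ω τ ρ h).map (fun y => (S y, y)) ∧
        IsConvexGradientOn Ω S ∧
        ∀ φ φs : Space d → ℝ, IsPotentialPair Ω Ψ τ γ φ φs →
          ∀ᵐ y ∂(volume.restrict Ω),
            DifferentiableAt ℝ φs y ∧ -gradient φs y = τ⁻¹ • (S y - y)) ∧
    (γ (frontier Ω ×ˢ frontier Ω) = 0 →
      ∀ γ' h', IsOptimalPair Ω Ψ e τ μ ρ γ' h' → γ' (frontier Ω ×ˢ frontier Ω) = 0 → γ' = γ) := by
  have hfr := frontier_nonempty_of_isBounded hd hΩ_bdd hΩ_ne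
  have hΨ := hcost.continuousOn
  have hmid := fun γ' h' (hopt' : IsOptimalPair Ω Ψ e τ μ ρ γ' h') =>
    hopt.midpoint hΩ_open hΩ_bdd hfr hcost hτ hμ_ac hρ_int hρ_nonneg hopt'
  have hpot : ∀ {γ' h'}, IsOptimalPair Ω Ψ e τ μ ρ γ' h' →
      ∃ φ φs : Space d → ℝ, IsPotentialPair Ω Ψ τ γ' φ φs := fun hopt' =>
    hopt'.exists_isPotentialPair hΩ_open hΩ_bdd hfr hcost hτ hμ_ac hρ_int hρ_nonneg
  have hbound : ∀ {γ' φ φs}, IsPotentialPair Ω Ψ τ γ' φ φs →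
      (∃ M, ∀ y ∈ closure Ω, φs y ≤ M) ∧ ∃ M, ∀ x ∈ closure Ω, φ x ≤ M := fun hp =>
    ⟨exists_le_of_eq_quadTransform hΩ_open hΩ_bdd hfr hΨ.neg hp.eq_transform_star hp.boundary_star,
      exists_le_of_eq_quadTransform hΩ_open hΩ_bdd hfr hΨ hp.eq_transform hp.boundary⟩
  have htac : targetMeasure Ω τ ρ h ≪ volume.restrict Ω := withDensity_absolutelyContinuous _ _
  have htac' : volume.restrict Ω ≪ targetMeasure Ω τ ρ h := by
    refine withDensity_absolutelyContinuous'
      (hρ_int.add (hopt.1.integrable.const_mul τ)).aemeasurable.ennreal_ofReal ?_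
    filter_upwards [hν_pos] with y hy
    exact (ENNReal.ofReal_pos.2 hy).ne'
  -- the plans into `Ω` are handled after exchanging the two variables
  have hswap : ∀ ν : Measure (Space d × Space d),
      (ν.map Prod.swap).map Prod.fst = ν.map Prod.snd := fun ν => by
    rw [Measure.map_map measurable_fst measurable_swap]
    rfl
  have hswap' : ∀ ν : Measure (Space d × Space d), (ν.map Prod.swap).map Prod.swap = ν := fun ν => by
    rw [Measure.map_map measurable_swap measurable_swap, Prod.swap_swap_eq, Measure.map_id]
  have hleft : ∀ γ' h', IsOptimalPair Ω Ψ e τ μ ρ γ' h' →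
      planRestrict γ' Ω (closure Ω) = planRestrict γ Ω (closure Ω) := by
    intro γ' h' hopt'
    obtain ⟨φ, φs, hp⟩ := hpot (hmid γ' h' hopt').1
    obtain ⟨M, hM⟩ := (hbound hp).1
    obtain ⟨h1, h2⟩ := ae_planRestrict_midPlan
      (hp.ae_mem_quadSuperdiff hΩ_open (hmid γ' h' hopt').1.1.supported)
    exact eq_of_ae_mem_quadSuperdiff hΩ_open hΩ_bdd hΩ_ne hτ hp.eq_transform hM
      (by rw [hopt.1.fst_marginal, hopt'.1.fst_marginal])
      (by rw [hopt'.1.fst_marginal]; exact hμ_ac) h2 h1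
  have hright : ∀ γ' h', IsOptimalPair Ω Ψ e τ μ ρ γ' h' →
      planRestrict γ' (closure Ω) Ω = planRestrict γ (closure Ω) Ω := by
    intro γ' h' hopt'
    obtain ⟨φ, φs, hp⟩ := hpot (hmid γ' h' hopt').1
    obtain ⟨M, hM⟩ := (hbound hp).2
    have hsw : MeasurableEmbedding (Prod.swap : Space d × Space d → Space d × Space d) :=
      MeasurableEquiv.prodComm.measurableEmbedding
    have hae := hp.ae_mem_quadSuperdiff_star hΩ_open (hmid γ' h' hopt').1.1.supported
    rw [hsw.ae_map_iff] at hae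
    obtain ⟨h1, h2⟩ := ae_planRestrict_midPlan hae
    have htarget : targetMeasure Ω τ ρ h' = targetMeasure Ω τ ρ h :=
      withDensity_congr_ae ((hmid γ' h' hopt').2.mono fun y hy => by simp only [hy])
    rw [← hswap' (planRestrict γ' (closure Ω) Ω), ← hswap' (planRestrict γ (closure Ω) Ω)]
    congr 1
    refine eq_of_ae_mem_quadSuperdiff hΩ_open hΩ_bdd hΩ_ne hτ hp.eq_transform_star hM ?_ ?_
      (hsw.ae_map_iff.2 h2) (hsw.ae_map_iff.2 h1)
    · rw [hswap, hswap, hopt.1.snd_marginal, hopt'.1.snd_marginal, htarget]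
    · rw [hswap, hopt'.1.snd_marginal, htarget]
      exact htac
  refine ⟨fun γ' h' hopt' => (hmid γ' h' hopt').2, hpot hopt, ⟨hleft, ?_⟩, ⟨hright, ?_⟩,
    fun hf γ' h' hopt' hf' => eq_of_planRestrict_eq hΩ_open hopt.1.supported hopt'.1.supported hf
      hf' (hleft γ' h' hopt') (hright γ' h' hopt')⟩
  · have hfst := hopt.1.fst_marginal
    have hac : (planRestrict γ Ω (closure Ω)).map Prod.fst ≪ volume.restrict Ω := hfst ▸ hμ_ac
    have hac' : volume.restrict Ω ≪ (planRestrict γ Ω (closure Ω)).map Prod.fst := hfst ▸ hμ_pos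
    obtain ⟨φ, φs, hp⟩ := hpot hopt
    obtain ⟨M, hM⟩ := (hbound hp).1
    obtain ⟨T, hT, hmaps, hplan, hconv⟩ := exists_transport_map hΩ_open hΩ_bdd hΩ_ne hτ
      hp.eq_transform hM hac hac' (hp.ae_mem_quadSuperdiff hΩ_open hopt.1.supported)
    refine ⟨T, hT, hmaps, hfst ▸ hplan, hconv, fun φ' φs' hp' => ?_⟩
    obtain ⟨M', hM'⟩ := (hbound hp').1
    exact ae_gradient_eq_of_transport_map hΩ_open hΩ_bdd hΩ_ne hτ hp'.eq_transform hM' hac hac'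
      (hp'.ae_mem_quadSuperdiff hΩ_open hopt.1.supported) hT hplan
  · have hfst : ((planRestrict γ (closure Ω) Ω).map Prod.swap).map Prod.fst
        = targetMeasure Ω τ ρ h := by rw [hswap, hopt.1.snd_marginal]
    have hac := hfst.symm ▸ htac
    have hac' := hfst.symm ▸ htac'
    obtain ⟨φ, φs, hp⟩ := hpot hopt
    obtain ⟨M, hM⟩ := (hbound hp).2
    obtain ⟨S, hS, hmaps, hplan, hconv⟩ := exists_transport_map hΩ_open hΩ_bdd hΩ_ne hτ
      hp.eq_transform_star hM hac hac'
      (hp.ae_mem_quadSuperdiff_star hΩ_open hopt.1.supported)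
    refine ⟨S, hS, hmaps, ?_, hconv, fun φ' φs' hp' => ?_⟩
    · rw [← hswap' (planRestrict γ (closure Ω) Ω), hplan, hfst,
        Measure.map_map measurable_swap (by fun_prop)]
      rfl
    · obtain ⟨M', hM'⟩ := (hbound hp').2
      exact ae_gradient_eq_of_transport_map hΩ_open hΩ_bdd hΩ_ne hτ hp'.eq_transform_star hM' hac
        hac' (hp'.ae_mem_quadSuperdiff_star hΩ_open hopt.1.supported) hS hplan
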